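/- **Setting.** Let $\mathcal D$ be a probability distribution of a pair $(f,y)\in[0,1]\times\{0,1\}$ (prediction and outcome), and let $h:[0,1]\to\mathbb R\cup\{\pm\infty\}$ be continuous and (strictly) increasing. Put $d_h(u,v)=\min(|h(u)-h(v)|,2)$. A distribution is *perfectly calibrated* if $\mathbb E[y\mid f]=f$ almost surely. Let $\underline{\mathrm{dCE}}_{d_h}(\mathcal D)=\inf_{\mathcal D'}W_1(\mathcal D,\mathcal D')$, the infimum being over all perfectly calibrated distributions $\mathcal D'$ on $[0,1]\times\{0,1\}$ and $W_1$ being the Wasserstein distance for the metric $d_h(f_1,f_2)+|y_1-y_2|$. For $\sigma>0$ let $\phi_\sigma(t)=e^{-t^2/2\sigma^2}/\sqrt{2\pi\sigma^2}$, with $\phi_\sigma(\pm\infty)=0$, and $$\mathsf{smECE}_{\sigma,h}(\mathcal D)=\int_{\mathbb R}\Bigl|\mathbb E_{(f,y)\sim\mathcal D}\,\phi_\sigma(t-h(f))\,(f-y)\Bigr|\,dt .$$ A number $\sigma_*\ge 0$ is a *fixed point* if either $\sigma_*>0$ and $\mathsf{smECE}_{\sigma_*,h}(\mathcal D)=\sigma_*$,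 or $\sigma_*=0$ and $\mathsf{smECE}_{\tau,h}(\mathcal D)=0$ for all $\tau>0$. **Theorem.** There is a universal constant $c>0$, and for every $L>0$ there is a constant $C>0$ depending only on $L$, such that the following holds for all $h$ and $\mathcal D$ as above for which, $\mathcal D$-almost surely, $h(f)$ is finite or $f=y$. There is exactly one fixed point $\sigma_*$, denoted $\mathsf{smECE}_{*,h}(\mathcal D)$, and $$\underline{\mathrm{dCE}}_{d_h}(\mathcal D)\le c\;\mathsf{smECE}_{*,h}(\mathcal D).$$ If moreover $|u-v|\le L\,d_h(u,v)$ for all $u,v\in[0,1]$, then $$\mathsf{smECE}_{*,h}(\mathcal D)\le C\sqrt{\underline{\mathrm{dCE}}_{d_h}(\mathcal D)} .$$ -/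

import Mathlib

open MeasureTheory
open scoped ENNReal

namespace SmoothECE

noncomputable section

/-- The sample space `[0,1] × {0,1}` of pairs (prediction, outcome). -/
abbrev Sample : Type := unitInterval × Bool

/-- The outcome `y ∈ {0,1}` as a real number. -/
def outcome (y : Bool) : ℝ := if y then 1 else 0

/-- The residual `f - y`. -/
def residual (p : Sample) : ℝ := (p.1 : ℝ) - outcome p.2

/-- Perfect calibration: `E[y | f] = f` almost surely. -/
def PerfectlyCalibrated (D : Measure Sample) : Prop :=
  condExp (MeasurableSpace.comap (Prod.fst : Sample → unitInterval) inferInstance) D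
    (fun p => outcome p.2) =ᵐ[D] fun p => (p.1 : ℝ)

/-- The couplings of two measures. -/
def Couplings {X : Type*} [MeasurableSpace X] (μ ν : Measure X) : Set (Measure (X × X)) :=
  {γ | γ.map Prod.fst = μ ∧ γ.map Prod.snd = ν}

/-- The Wasserstein distance `W₁` for the ground distance `d`. -/
def wasserstein {X : Type*} [MeasurableSpace X] (d : X → X → ℝ≥0∞) (μ ν : Measure X) : ℝ≥0∞ :=
  ⨅ γ ∈ Couplings μ ν, ∫⁻ p, d p.1 p.2 ∂γ

/-- The distance `d(f₁, f₂) + |y₁ - y₂|` on `[0,1] × {0,1}`. -/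
def sampleDist (d : unitInterval → unitInterval → ℝ≥0∞) (p q : Sample) : ℝ≥0∞ :=
  d p.1 q.1 + ENNReal.ofReal |outcome p.2 - outcome q.2|

/-- The distance to calibration: the Wasserstein distance to the nearest perfectly calibrated
probability distribution. -/
def dCE (d : unitInterval → unitInterval → ℝ≥0∞) (D : Measure Sample) : ℝ≥0∞ :=
  ⨅ D' ∈ {D' : Measure Sample | IsProbabilityMeasure D' ∧ PerfectlyCalibrated D'},
    wasserstein (sampleDist d) D D'

/-- The distance `|a - b|` on `ℝ ∪ {±∞}`. The case distinction is needed because the difference of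
`±∞` with itself is not zero in `EReal`. -/
def extDist (a b : EReal) : ℝ≥0∞ := if a = b then 0 else (a - b).abs

/-- The metric `d_h(u, v) = min(|h(u) - h(v)|, 2)` on `[0,1]`. -/
def inducedDist (h : unitInterval → EReal) (u v : unitInterval) : ℝ≥0∞ := min (extDist (h u) (h v)) 2

/-- The Gaussian kernel `φ_σ(t - s)` of scale (standard deviation) `σ`, with its limit value `0` at
`s = ±∞`. -/
def gaussianKernel (σ : ℝ) (t : ℝ) (s : EReal) : ℝ :=
  if s = ⊥ ∨ s = ⊤ then 0
  else ProbabilityTheory.gaussianPDFReal s.toReal ⟨σ ^ 2, sq_nonneg σ⟩ t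

/-- `smECE_{K,h}(D) = ∫ |E_{(f,y) ∼ D} K(t, h(f)) (f - y)| dt`. -/
def smECEKernel (K : ℝ → EReal → ℝ) (h : unitInterval → EReal) (D : Measure Sample) : ℝ :=
  ∫ t : ℝ, |∫ p, K t (h p.1) * residual p ∂D|

/-- `smECE_{σ,h}(D)`, for a scale `σ > 0`. -/
def smECE (σ : ℝ) (h : unitInterval → EReal) (D : Measure Sample) : ℝ :=
  smECEKernel (gaussianKernel σ) h D

/-- `σ` is the value `smECE_{*,h}(D)`, i.e. a fixed point of `τ ↦ smECE_{τ,h}(D)` on `[0, ∞)`.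
There is no Gaussian kernel of scale zero; the value at scale zero is the limit as `τ ↓ 0`, which,
the function being nonnegative and nonincreasing, is zero exactly when the function vanishes. -/
def IsSmECEStar (h : unitInterval → EReal) (D : Measure Sample) (σ : ℝ) : Prop :=
  (0 < σ ∧ smECE σ h D = σ) ∨ (σ = 0 ∧ ∀ τ : ℝ, 0 < τ → smECE τ h D = 0)

end

end SmoothECE

/-!
The proof is direct: the upper bound on the distance to calibration comes from an explicit
coupling, the lower bound from a Lipschitz estimate, and no linear programming duality is needed.

*Fixed point.* Gaussian kernels form a convolution semigroup, so `σ ↦ smECE_σ` is nonincreasing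
(`smECE_antitone`); the pointwise bound `φ_σ ≤ (τ / σ) φ_τ` for `σ ≤ τ` makes it continuous
(`continuousOn_smECE`). Since it is at most `1`, it meets the diagonal exactly once unless it
vanishes identically (`existsUnique_isSmECEStar`).

*Upper bound on the distance to calibration.* The calibrated distribution to compare `D` with is
its recalibration, which keeps the law of `f` and resamples `y` as a Bernoulli variable with mean
`f`. This changes `y` with probability `|f - y|`, so that it moves the measure
`A = (f - y)⁺ D` from `y = 0` to `y = 1` and the measure `B = (f - y)⁻ D` from `y = 1` to `y = 0`.
Instead of changing both outcomes, a sample `(f, 0)` from `A` and a sample `(f', 1)` from `B` can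
exchange their predictions, at cost `2 d_h(f, f')`. To find partners, smooth the images of `A` and
`B` under `h` by the Gaussian kernel of scale `σ`, to densities `a` and `b`. The common part
`min(a, b)`, carried back to `A` and to `B`, is a partial coupling of `A` and `B` that moves `h(f)`
by `O(σ)`, and it leaves out mass `∫ |a - b| = smECE_σ(D)` (`exists_partial_coupling`). What is left
out changes its outcome, at cost `1` per unit of mass. Altogether the distance to calibration is at
most `2 σ + smECE_σ(D)` for every `σ > 0` (`dCE_le_ofReal_add_smECE`), which is `3 σ` at the fixed
point. Points with `h(f) = ±∞` are charged neither by `A` nor by `B`, by the hypothesis on `D`.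

*Lower bound on the distance to calibration.* The map from a sample `(f, y)` to the function
`φ_σ(· - h(f)) (f - y)` in `L¹(ℝ)` is Lipschitz with constant `L + 2 + 1 / σ` for the ground
distance (`lintegral_abs_gaussianKernel_mul_residual_sub_le`), and its mean under a calibrated
distribution is zero. Hence `smECE_σ(D) ≤ (L + 2 + 1 / σ) dCE(D)` (`ofReal_smECE_le_mul_dCE`). At
the fixed point, where `σ ≤ 1`, this gives `σ ^ 2 ≤ (L + 3) dCE(D)`.
-/

namespace SmoothECE

/-! ### The Gaussian kernel -/

lemma gaussianKernel_coe (σ t x : ℝ) :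
    gaussianKernel σ t (x : EReal) =
      ProbabilityTheory.gaussianPDFReal x (σ ^ 2).toNNReal t := by
  have h : (⟨σ ^ 2, sq_nonneg σ⟩ : NNReal) = (σ ^ 2).toNNReal :=
    (Real.toNNReal_of_nonneg (sq_nonneg σ)).symm
  rw [← h]
  simp [gaussianKernel]

lemma gaussianKernel_coe_eq (σ t x : ℝ) :
    gaussianKernel σ t (x : EReal) =
      (√(2 * Real.pi * σ ^ 2))⁻¹ * Real.exp (-(t - x) ^ 2 / (2 * σ ^ 2)) := by
  rw [gaussianKernel_coe, ProbabilityTheory.gaussianPDFReal_def,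
    Real.coe_toNNReal _ (sq_nonneg σ)]

@[simp] lemma gaussianKernel_bot (σ t : ℝ) : gaussianKernel σ t ⊥ = 0 := by simp [gaussianKernel]

@[simp] lemma gaussianKernel_top (σ t : ℝ) : gaussianKernel σ t ⊤ = 0 := by simp [gaussianKernel]

lemma gaussianKernel_nonneg (σ t : ℝ) (s : EReal) : 0 ≤ gaussianKernel σ t s := by
  unfold gaussianKernel
  split_ifs
  · exact le_rfl
  · exact ProbabilityTheory.gaussianPDFReal_nonneg _ _ _

lemma gaussianKernel_le (σ t : ℝ) (s : EReal) :
    gaussianKernel σ t s ≤ (√(2 * Real.pi * σ ^ 2))⁻¹ := by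
  induction s with
  | bot => simp
  | top => simp
  | coe x =>
    rw [gaussianKernel_coe_eq]
    refine mul_le_of_le_one_right (by positivity) (Real.exp_le_one_iff.2 ?_)
    rw [neg_div]
    exact neg_nonpos.2 (by positivity)

lemma measurable_gaussianKernel (σ : ℝ) :
    Measurable fun q : ℝ × EReal => gaussianKernel σ q.1 q.2 := by
  refine Measurable.ite ?_ measurable_const ?_
  · exact (measurable_snd (measurableSet_singleton _)).union
      (measurable_snd (measurableSet_singleton _))
  · exact ProbabilityTheory.measurable_uncurry_gaussianPDFReal.comp
      (f := fun q : ℝ × EReal => (q.2.toReal, (⟨σ ^ 2, sq_nonneg σ⟩ : NNReal), q.1))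
      (measurable_snd.ereal_toReal.prodMk (measurable_const.prodMk measurable_fst))

@[fun_prop]
lemma Measurable.gaussianKernel {α : Type*} [MeasurableSpace α] (σ : ℝ) {f : α → ℝ}
    {g : α → EReal} (hf : Measurable f) (hg : Measurable g) :
    Measurable fun a => gaussianKernel σ (f a) (g a) :=
  (measurable_gaussianKernel σ).comp (hf.prodMk hg)

lemma variance_ne_zero {σ : ℝ} (hσ : 0 < σ) : (σ ^ 2).toNNReal ≠ 0 :=
  (Real.toNNReal_pos.2 (by positivity)).ne'

lemma lintegral_gaussianKernel_coe {σ : ℝ} (hσ : 0 < σ) (x : ℝ) :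
    ∫⁻ t, ENNReal.ofReal (gaussianKernel σ t (x : EReal)) = 1 := by
  simp_rw [gaussianKernel_coe]
  exact ProbabilityTheory.lintegral_gaussianPDFReal_eq_one x (variance_ne_zero hσ)

lemma lintegral_gaussianKernel_le_one {σ : ℝ} (hσ : 0 < σ) (s : EReal) :
    ∫⁻ t, ENNReal.ofReal (gaussianKernel σ t s) ≤ 1 := by
  induction s with
  | bot => simp
  | top => simp
  | coe x => exact (lintegral_gaussianKernel_coe hσ x).le

lemma lintegral_mul_gaussianKernel_coe {σ : ℝ} (hσ : 0 < σ) (x : ℝ) {g : ℝ → ℝ≥0∞}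
    (hg : Measurable g) :
    ∫⁻ t, g t * ENNReal.ofReal (gaussianKernel σ t (x : EReal)) =
      ∫⁻ t, g t ∂(ProbabilityTheory.gaussianReal x (σ ^ 2).toNNReal) := by
  rw [ProbabilityTheory.gaussianReal_of_var_ne_zero _ (variance_ne_zero hσ),
    lintegral_withDensity_eq_lintegral_mul _ (ProbabilityTheory.measurable_gaussianPDF _ _) hg]
  refine lintegral_congr fun t => ?_
  rw [gaussianKernel_coe, mul_comm]
  rfl

/-- The first absolute moment of a Gaussian is at most its standard deviation. -/
lemma lintegral_abs_sub_mul_gaussianKernel_le {σ : ℝ} (hσ : 0 < σ) (x : ℝ) :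
    ∫⁻ t, ENNReal.ofReal |t - x| * ENNReal.ofReal (gaussianKernel σ t (x : EReal)) ≤
      ENNReal.ofReal σ := by
  rw [lintegral_mul_gaussianKernel_coe hσ x (by fun_prop)]
  set P := ProbabilityTheory.gaussianReal x (σ ^ 2).toNNReal
  have hvar : ∫⁻ t, ENNReal.ofReal ((t - x) ^ 2) ∂P = ENNReal.ofReal (σ ^ 2) := by
    have hm : MemLp (fun t : ℝ => t) 2 P := ProbabilityTheory.memLp_id_gaussianReal 2
    have h1 := ProbabilityTheory.ofReal_variance hm
    rw [ProbabilityTheory.variance_fun_id_gaussianReal, Real.coe_toNNReal _ (sq_nonneg σ),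
      ProbabilityTheory.evariance] at h1
    rw [h1]
    refine lintegral_congr fun t => ?_
    rw [ProbabilityTheory.integral_id_gaussianReal, ← ofReal_norm, Real.norm_eq_abs,
      ← ENNReal.ofReal_pow (abs_nonneg _), sq_abs]
  calc ∫⁻ t, ENNReal.ofReal |t - x| ∂P
      ≤ ∫⁻ t, (ENNReal.ofReal (σ / 2) +
          ENNReal.ofReal (1 / (2 * σ)) * ENNReal.ofReal ((t - x) ^ 2)) ∂P := by
        refine lintegral_mono fun t => ?_
        rw [← ENNReal.ofReal_mul (by positivity), ← ENNReal.ofReal_add (by positivity)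
          (by positivity)]
        refine ENNReal.ofReal_le_ofReal ?_
        -- the arithmetic-geometric mean inequality for `σ` and `(t - x) ^ 2 / σ`
        have : σ / 2 + 1 / (2 * σ) * (t - x) ^ 2 - |t - x| = (|t - x| - σ) ^ 2 / (2 * σ) := by
          rw [← sq_abs (t - x)]
          field_simp
          ring
        have h2 : 0 ≤ (|t - x| - σ) ^ 2 / (2 * σ) := by positivity
        linarith
    _ = ENNReal.ofReal σ := by
        rw [lintegral_add_left measurable_const, lintegral_const_mul _ (by fun_prop), hvar]
        simp only [lintegral_const, measure_univ, mul_one]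
        rw [← ENNReal.ofReal_mul (by positivity), ← ENNReal.ofReal_add (by positivity)
          (by positivity)]
        congr 1
        field_simp
        ring

lemma extDist_coe (x y : ℝ) : extDist (x : EReal) y = ENNReal.ofReal |x - y| := by
  unfold extDist
  split_ifs with h
  · simp [EReal.coe_eq_coe_iff.1 h]
  · rw [← EReal.coe_sub, EReal.abs_def]

lemma extDist_comm (a b : EReal) : extDist a b = extDist b a := by
  unfold extDist
  by_cases h : a = b
  · simp [h]
  · rw [if_neg h, if_neg (Ne.symm h)]
    induction a <;> induction b <;> simp_all [← EReal.coe_sub, EReal.abs_def, abs_sub_comm]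

lemma extDist_bot_coe (x : ℝ) : extDist ⊥ (x : EReal) = ∞ := by simp [extDist]

lemma extDist_top_coe (x : ℝ) : extDist ⊤ (x : EReal) = ∞ := by simp [extDist]

lemma hasDerivAt_gaussianKernel_coe {σ : ℝ} (hσ : 0 < σ) (t s : ℝ) :
    HasDerivAt (fun s : ℝ => gaussianKernel σ t (s : EReal))
      ((t - s) / σ ^ 2 * gaussianKernel σ t (s : EReal)) s := by
  simp_rw [gaussianKernel_coe_eq]
  have h1 : HasDerivAt (fun s : ℝ => -(t - s) ^ 2 / (2 * σ ^ 2)) ((t - s) / σ ^ 2) s := by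
    have := ((((hasDerivAt_id s).const_sub t).pow 2).neg).div_const (2 * σ ^ 2)
    refine this.congr_deriv ?_
    simp
    field_simp
  refine (h1.exp.const_mul _).congr_deriv ?_
  ring

/-- Translating a Gaussian kernel moves it in `L¹` by at most the shift divided by `σ`: the
`L¹` norm of its derivative is its first absolute moment divided by `σ ^ 2`. -/
lemma lintegral_abs_gaussianKernel_coe_sub_le {σ : ℝ} (hσ : 0 < σ) {x y : ℝ} (hxy : x ≤ y) :
    ∫⁻ t, ENNReal.ofReal |gaussianKernel σ t (x : EReal) - gaussianKernel σ t (y : EReal)| ≤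
      ENNReal.ofReal (1 / σ) * ENNReal.ofReal |x - y| := by
  calc _ ≤ ∫⁻ t, ∫⁻ s in Set.Ioc x y, ENNReal.ofReal (1 / σ ^ 2) * (ENNReal.ofReal |t - s| *
          ENNReal.ofReal (gaussianKernel σ t (s : EReal))) := by
        refine lintegral_mono fun t => ?_
        have hcont : Continuous fun s : ℝ =>
            (t - s) / σ ^ 2 * gaussianKernel σ t (s : EReal) := by
          simp_rw [gaussianKernel_coe_eq]
          fun_prop
        have hFTC := intervalIntegral.integral_eq_sub_of_hasDerivAt (a := x) (b := y)
          (fun s _ => hasDerivAt_gaussianKernel_coe hσ t s) (hcont.intervalIntegrable x y)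
        rw [abs_sub_comm, ← hFTC, intervalIntegral.integral_of_le hxy, ← Real.norm_eq_abs,
          ofReal_norm]
        refine (enorm_integral_le_lintegral_enorm _).trans (lintegral_mono fun s => ?_)
        rw [← ofReal_norm, Real.norm_eq_abs, abs_mul,
          abs_of_nonneg (gaussianKernel_nonneg _ _ _), abs_div, abs_of_nonneg (sq_nonneg σ),
          ← ENNReal.ofReal_mul (abs_nonneg _), ← ENNReal.ofReal_mul (by positivity)]
        refine ENNReal.ofReal_le_ofReal (le_of_eq ?_)
        ring
    _ = ∫⁻ s in Set.Ioc x y, ∫⁻ t, ENNReal.ofReal (1 / σ ^ 2) * (ENNReal.ofReal |t - s| *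
          ENNReal.ofReal (gaussianKernel σ t (s : EReal))) := by
        refine lintegral_lintegral_swap (Measurable.aemeasurable ?_)
        unfold Function.uncurry
        fun_prop
    _ ≤ ∫⁻ _ in Set.Ioc x y, ENNReal.ofReal (1 / σ) := by
        refine lintegral_mono fun s => ?_
        rw [lintegral_const_mul _ (by fun_prop)]
        refine (mul_le_mul_right (lintegral_abs_sub_mul_gaussianKernel_le hσ s) _).trans ?_
        rw [← ENNReal.ofReal_mul (by positivity)]
        refine ENNReal.ofReal_le_ofReal (le_of_eq ?_)
        field_simp
    _ = _ := by
        rw [setLIntegral_const, Real.volume_Ioc, abs_sub_comm, abs_of_nonneg (sub_nonneg.2 hxy)]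

lemma lintegral_abs_gaussianKernel_sub_le_two {σ : ℝ} (hσ : 0 < σ) (a b : EReal) :
    ∫⁻ t, ENNReal.ofReal |gaussianKernel σ t a - gaussianKernel σ t b| ≤ 2 := by
  calc _ ≤ ∫⁻ t, (ENNReal.ofReal (gaussianKernel σ t a) +
          ENNReal.ofReal (gaussianKernel σ t b)) := by
        refine lintegral_mono fun t => ?_
        rw [← ENNReal.ofReal_add (gaussianKernel_nonneg _ _ _) (gaussianKernel_nonneg _ _ _)]
        refine ENNReal.ofReal_le_ofReal ((abs_sub _ _).trans_eq ?_)
        rw [abs_of_nonneg (gaussianKernel_nonneg _ _ _),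
          abs_of_nonneg (gaussianKernel_nonneg _ _ _)]
    _ ≤ 1 + 1 := by
        rw [lintegral_add_left (by fun_prop)]
        exact add_le_add (lintegral_gaussianKernel_le_one hσ a)
          (lintegral_gaussianKernel_le_one hσ b)
    _ = 2 := one_add_one_eq_two

/-- The map `s ↦ φ_σ(· - s)` from `ℝ ∪ {±∞}` to `L¹` is Lipschitz for the truncated distance. -/
lemma lintegral_abs_gaussianKernel_sub_le {σ : ℝ} (hσ : 0 < σ) (a b : EReal) :
    ∫⁻ t, ENNReal.ofReal |gaussianKernel σ t a - gaussianKernel σ t b| ≤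
      ENNReal.ofReal (1 + 1 / σ) * min (extDist a b) 2 := by
  have hone : 1 ≤ ENNReal.ofReal (1 + 1 / σ) :=
    ENNReal.one_le_ofReal.2 (by have := one_div_pos.2 hσ; linarith)
  have far {c d : EReal} (h : 2 ≤ extDist c d) :
      ∫⁻ t, ENNReal.ofReal |gaussianKernel σ t c - gaussianKernel σ t d| ≤
        ENNReal.ofReal (1 + 1 / σ) * min (extDist c d) 2 := by
    rw [min_eq_right h]
    exact (lintegral_abs_gaussianKernel_sub_le_two hσ c d).trans (le_mul_of_one_le_left' hone)
  have comm {c d : EReal} (h : ∫⁻ t, ENNReal.ofReal |gaussianKernel σ t c - gaussianKernel σ t d| ≤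
        ENNReal.ofReal (1 + 1 / σ) * min (extDist c d) 2) :
      ∫⁻ t, ENNReal.ofReal |gaussianKernel σ t d - gaussianKernel σ t c| ≤
        ENNReal.ofReal (1 + 1 / σ) * min (extDist d c) 2 := by
    simp_rw [abs_sub_comm (gaussianKernel σ _ d), extDist_comm d]
    exact h
  have real {x y : ℝ} (hxy : x ≤ y) : ∫⁻ t, ENNReal.ofReal
        |gaussianKernel σ t (x : EReal) - gaussianKernel σ t (y : EReal)| ≤
        ENNReal.ofReal (1 + 1 / σ) * min (extDist (x : EReal) y) 2 := by
    rcases le_total 2 (extDist (x : EReal) y) with h | h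
    · exact far h
    · rw [min_eq_left h, extDist_coe]
      refine (lintegral_abs_gaussianKernel_coe_sub_le hσ hxy).trans (mul_le_mul_left ?_ _)
      exact ENNReal.ofReal_le_ofReal (by linarith)
  induction a with
  | bot =>
    induction b with
    | bot => simp
    | top => simp
    | coe y => exact far (by simp [extDist_bot_coe])
  | top =>
    induction b with
    | bot => simp
    | top => simp
    | coe y => exact far (by simp [extDist_top_coe])
  | coe x =>
    induction b with
    | bot => exact comm (far (by simp [extDist_bot_coe]))
    | top => exact comm (far (by simp [extDist_top_coe]))
    | coe y =>
      rcases le_total x y with h | h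
      · exact real h
      · exact comm (real h)

/-- Gaussian kernels of neighbouring scales are close in `L¹`. This follows from the pointwise
bound `φ_σ ≤ (τ / σ) φ_τ`, which turns the `L¹` distance into a difference of masses. -/
lemma lintegral_abs_gaussianKernel_scale_sub_le {σ τ : ℝ} (hσ : 0 < σ) (hστ : σ ≤ τ) (s : EReal) :
    ∫⁻ t, ENNReal.ofReal |gaussianKernel σ t s - gaussianKernel τ t s| ≤
      ENNReal.ofReal (2 * (τ / σ - 1)) := by
  have hτ : 0 < τ := hσ.trans_le hστ
  have hr : 0 ≤ τ / σ - 1 := by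
    rw [sub_nonneg, one_le_div hσ]
    exact hστ
  have hint (ρ x : ℝ) : Integrable fun t => gaussianKernel ρ t (x : EReal) := by
    simp_rw [gaussianKernel_coe]
    exact ProbabilityTheory.integrable_gaussianPDFReal _ _
  have hmass {ρ : ℝ} (hρ : 0 < ρ) (x : ℝ) : ∫ t, gaussianKernel ρ t (x : EReal) = 1 := by
    simp_rw [gaussianKernel_coe]
    exact ProbabilityTheory.integral_gaussianPDFReal_eq_one _ (variance_ne_zero hρ)
  induction s with
  | bot => simp
  | top => simp
  | coe x =>
    have hle (t : ℝ) :
        gaussianKernel σ t (x : EReal) ≤ τ / σ * gaussianKernel τ t (x : EReal) := by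
      rw [gaussianKernel_coe_eq, gaussianKernel_coe_eq, Real.sqrt_mul (by positivity) (σ ^ 2),
        Real.sqrt_mul (by positivity) (τ ^ 2), Real.sqrt_sq hσ.le, Real.sqrt_sq hτ.le]
      have : τ / σ * ((√(2 * Real.pi) * τ)⁻¹ * Real.exp (-(t - x) ^ 2 / (2 * τ ^ 2))) =
          (√(2 * Real.pi) * σ)⁻¹ * Real.exp (-(t - x) ^ 2 / (2 * τ ^ 2)) := by
        have : 0 < √(2 * Real.pi) := by positivity
        field_simp
      rw [this]
      refine mul_le_mul_of_nonneg_left (Real.exp_le_exp.2 ?_) (by positivity)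
      rw [neg_div, neg_div, neg_le_neg_iff]
      gcongr
    have habs : Integrable fun t =>
        |gaussianKernel σ t (x : EReal) - gaussianKernel τ t (x : EReal)| :=
      ((hint σ x).sub (hint τ x)).abs
    rw [← ofReal_integral_eq_lintegral_ofReal habs
      (Filter.Eventually.of_forall fun t => abs_nonneg _)]
    refine ENNReal.ofReal_le_ofReal ?_
    calc ∫ t, |gaussianKernel σ t (x : EReal) - gaussianKernel τ t (x : EReal)|
        ≤ ∫ t, ((2 * (τ / σ) - 1) * gaussianKernel τ t (x : EReal) -
            gaussianKernel σ t (x : EReal)) := by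
          refine integral_mono habs
            (((hint τ x).const_mul _).sub (hint σ x)) fun t => ?_
          -- with `r = τ / σ ≥ 1`, both signs of the difference are bounded using `φ_σ ≤ r φ_τ`
          -- and `φ_τ ≤ r φ_τ`
          have h1 := hle t
          have h2 := mul_nonneg hr (gaussianKernel_nonneg τ t (x : EReal))
          refine abs_le.2 ⟨?_, ?_⟩ <;> nlinarith
      _ = 2 * (τ / σ - 1) := by
          rw [integral_sub ((hint τ x).const_mul _) (hint σ x), integral_const_mul, hmass hσ,
            hmass hτ]
          ring

/-! ### The smoothed calibration error as a function of the scale -/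

lemma measurable_outcome : Measurable outcome := measurable_of_finite _

lemma outcome_true : outcome true = 1 := rfl

lemma outcome_false : outcome false = 0 := rfl

lemma measurable_residual : Measurable residual :=
  (measurable_subtype_coe.comp measurable_fst).sub (measurable_outcome.comp measurable_snd)

@[fun_prop]
lemma Measurable.residual {α : Type*} [MeasurableSpace α] {f : α → Sample} (hf : Measurable f) :
    Measurable fun a => residual (f a) :=
  measurable_residual.comp hf

lemma abs_residual_le_one (p : Sample) : |residual p| ≤ 1 := by
  obtain ⟨⟨f, h0, h1⟩, y⟩ := p
  cases y <;> simp [residual, outcome, abs_le] <;> constructor <;> linarith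

lemma lintegral_abs_integral_le {X : Type*} [MeasurableSpace X] {D : Measure X} [SFinite D]
    {w : ℝ → X → ℝ} (hw : Measurable (Function.uncurry w)) :
    ∫⁻ t : ℝ, ENNReal.ofReal |∫ x, w t x ∂D| ≤
      ∫⁻ x, ∫⁻ t : ℝ, ENNReal.ofReal |w t x| ∂volume ∂D := by
  rw [← lintegral_lintegral_swap
    (f := fun t x => ENNReal.ofReal |w t x|) hw.abs.ennreal_ofReal.aemeasurable]
  refine lintegral_mono fun t => ?_
  simp_rw [← Real.norm_eq_abs, ofReal_norm]
  exact enorm_integral_le_lintegral_enorm _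

section

variable {h : unitInterval → EReal} {D : Measure Sample}

lemma measurable_gaussianKernel_mul_residual (hh : Measurable h) (σ : ℝ) :
    Measurable (Function.uncurry fun (t : ℝ) (p : Sample) =>
      gaussianKernel σ t (h p.1) * residual p) := by
  unfold Function.uncurry
  fun_prop

lemma lintegral_abs_gaussianKernel_mul_residual_le {σ : ℝ} (hσ : 0 < σ) (a : EReal)
    (p : Sample) : ∫⁻ t, ENNReal.ofReal |gaussianKernel σ t a * residual p| ≤ 1 := by
  refine (lintegral_mono fun t => ENNReal.ofReal_le_ofReal ?_).trans
    (lintegral_gaussianKernel_le_one hσ a)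
  rw [abs_mul, abs_of_nonneg (gaussianKernel_nonneg _ _ _)]
  exact mul_le_of_le_one_right (gaussianKernel_nonneg _ _ _) (abs_residual_le_one p)

lemma integrable_gaussianKernel_mul_residual [IsFiniteMeasure D] (hh : Measurable h) (σ t : ℝ) :
    Integrable (fun p : Sample => gaussianKernel σ t (h p.1) * residual p) D := by
  refine Integrable.of_bound (Measurable.aestronglyMeasurable (by fun_prop))
    ((√(2 * Real.pi * σ ^ 2))⁻¹) (Filter.Eventually.of_forall fun p => ?_)
  rw [Real.norm_eq_abs, abs_mul, abs_of_nonneg (gaussianKernel_nonneg _ _ _)]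
  exact (mul_le_of_le_one_right (gaussianKernel_nonneg _ _ _) (abs_residual_le_one p)).trans
    (gaussianKernel_le _ _ _)

lemma smECE_nonneg (σ : ℝ) : 0 ≤ smECE σ h D := integral_nonneg fun _ => abs_nonneg _

variable [IsProbabilityMeasure D]

lemma integrable_uncurry_gaussianKernel_mul_residual (hh : Measurable h) {σ : ℝ} (hσ : 0 < σ) :
    Integrable (Function.uncurry fun (t : ℝ) (p : Sample) =>
      gaussianKernel σ t (h p.1) * residual p) (volume.prod D) := by
  have hm := measurable_gaussianKernel_mul_residual hh σ
  refine ⟨hm.aestronglyMeasurable, ?_⟩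
  rw [HasFiniteIntegral, lintegral_prod_symm' _ hm.enorm]
  refine lt_of_le_of_lt (lintegral_mono (g := fun _ => 1) fun p => ?_) (by simp)
  simp_rw [← ofReal_norm, Real.norm_eq_abs]
  exact lintegral_abs_gaussianKernel_mul_residual_le hσ (h p.1) p

/-- The smoothed residual `t ↦ E[φ_σ(t - h(f)) (f - y)]` is integrable. -/
lemma integrable_integral_gaussianKernel_mul_residual (hh : Measurable h) {σ : ℝ} (hσ : 0 < σ) :
    Integrable fun t : ℝ => ∫ p, gaussianKernel σ t (h p.1) * residual p ∂D :=
  (integrable_uncurry_gaussianKernel_mul_residual hh hσ).integral_prod_left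

lemma ofReal_smECE (hh : Measurable h) {σ : ℝ} (hσ : 0 < σ) :
    ENNReal.ofReal (smECE σ h D) =
      ∫⁻ t, ENNReal.ofReal |∫ p, gaussianKernel σ t (h p.1) * residual p ∂D| :=
  ofReal_integral_eq_lintegral_ofReal
    (integrable_integral_gaussianKernel_mul_residual hh hσ).abs
    (Filter.Eventually.of_forall fun _ => abs_nonneg _)

lemma smECE_le_one (hh : Measurable h) {σ : ℝ} (hσ : 0 < σ) : smECE σ h D ≤ 1 := by
  rw [← ENNReal.ofReal_le_one, ofReal_smECE hh hσ]
  refine (lintegral_abs_integral_le (measurable_gaussianKernel_mul_residual hh σ)).trans ?_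
  refine (lintegral_mono fun p =>
    lintegral_abs_gaussianKernel_mul_residual_le hσ (h p.1) p).trans ?_
  simp

/-- The semigroup property of the Gaussian kernels. By completing the square,
`φ_ρ(t - x) φ_σ(x - s) = φ_τ(t - s) φ_{ρσ/τ}(x - m)` for a suitable `m`. -/
lemma integral_gaussianKernel_mul_gaussianKernel {ρ σ τ : ℝ} (hρ : 0 < ρ) (hσ : 0 < σ)
    (hτ : 0 < τ) (h2 : ρ ^ 2 + σ ^ 2 = τ ^ 2) (t : ℝ) (a : EReal) :
    ∫ x : ℝ, gaussianKernel ρ t (x : EReal) * gaussianKernel σ x a = gaussianKernel τ t a := by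
  induction a with
  | bot => simp
  | top => simp
  | coe s =>
    have key (x : ℝ) : gaussianKernel ρ t (x : EReal) * gaussianKernel σ x (s : EReal) =
        gaussianKernel τ t (s : EReal) *
          gaussianKernel (ρ * σ / τ) x (((σ ^ 2 * t + ρ ^ 2 * s) / τ ^ 2 : ℝ) : EReal) := by
      simp_rw [gaussianKernel_coe_eq]
      rw [mul_mul_mul_comm, ← Real.exp_add, mul_mul_mul_comm, ← Real.exp_add]
      congr 1
      · rw [← mul_inv, ← mul_inv, ← Real.sqrt_mul (by positivity),
          ← Real.sqrt_mul (by positivity)]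
        congr 2
        field_simp
      · congr 1
        have hσ2 : σ ^ 2 = τ ^ 2 - ρ ^ 2 := by linarith
        have hne : τ ^ 2 - ρ ^ 2 ≠ 0 := by rw [← hσ2]; positivity
        rw [div_pow, mul_pow, hσ2]
        field_simp
        ring
    simp_rw [key]
    rw [integral_const_mul]
    simp_rw [gaussianKernel_coe _ _ ((σ ^ 2 * t + ρ ^ 2 * s) / τ ^ 2)]
    rw [ProbabilityTheory.integral_gaussianPDFReal_eq_one _ (variance_ne_zero (by positivity)),
      mul_one]

/-- Smoothing at a larger scale is a further convolution with a probability density, which does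
not increase the `L¹` norm. -/
lemma smECE_antitone (hh : Measurable h) {σ τ : ℝ} (hσ : 0 < σ) (hστ : σ ≤ τ) :
    smECE τ h D ≤ smECE σ h D := by
  rcases hστ.eq_or_lt with rfl | hlt
  · exact le_rfl
  have hτ : 0 < τ := hσ.trans hlt
  have hpos : 0 < τ ^ 2 - σ ^ 2 := by nlinarith
  set ρ := √(τ ^ 2 - σ ^ 2) with hρdef
  have hρ : 0 < ρ := Real.sqrt_pos.2 hpos
  have h2 : ρ ^ 2 + σ ^ 2 = τ ^ 2 := by rw [hρdef, Real.sq_sqrt hpos.le]; ring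
  set F : ℝ → ℝ := fun t => ∫ p, gaussianKernel σ t (h p.1) * residual p ∂D with hF
  have hFm : Measurable F :=
    (measurable_gaussianKernel_mul_residual hh σ).stronglyMeasurable.integral_prod_right.measurable
  have hconv (t : ℝ) : ∫ p, gaussianKernel τ t (h p.1) * residual p ∂D =
      ∫ x : ℝ, gaussianKernel ρ t (x : EReal) * F x := by
    have hint : Integrable (Function.uncurry fun (x : ℝ) (p : Sample) =>
        gaussianKernel ρ t (x : EReal) * (gaussianKernel σ x (h p.1) * residual p))
        (volume.prod D) := by
      refine (integrable_uncurry_gaussianKernel_mul_residual (D := D) hh hσ).bdd_mul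
        (f := fun q : ℝ × Sample => gaussianKernel ρ t (q.1 : EReal))
        (c := (√(2 * Real.pi * ρ ^ 2))⁻¹) (Measurable.aestronglyMeasurable (by fun_prop))
        (Filter.Eventually.of_forall fun q => ?_)
      rw [Real.norm_eq_abs, abs_of_nonneg (gaussianKernel_nonneg _ _ _)]
      exact gaussianKernel_le _ _ _
    simp_rw [hF, ← integral_const_mul]
    rw [integral_integral_swap hint]
    refine integral_congr_ae (Filter.Eventually.of_forall fun p => ?_)
    simp_rw [← mul_assoc]
    rw [integral_mul_const, integral_gaussianKernel_mul_gaussianKernel hρ hσ hτ h2]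
  rw [← ENNReal.ofReal_le_ofReal_iff (smECE_nonneg σ), ofReal_smECE hh hτ, ofReal_smECE hh hσ]
  simp_rw [hconv]
  refine (lintegral_abs_integral_le (by unfold Function.uncurry; fun_prop)).trans
    (lintegral_mono fun x => ?_)
  simp_rw [abs_mul, abs_of_nonneg (gaussianKernel_nonneg _ _ _),
    ENNReal.ofReal_mul (gaussianKernel_nonneg _ _ _)]
  rw [lintegral_mul_const _ (by fun_prop)]
  exact mul_le_of_le_one_left' (lintegral_gaussianKernel_coe hρ x).le

lemma smECE_le_add (hh : Measurable h) {σ τ : ℝ} (hσ : 0 < σ) (hστ : σ ≤ τ) :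
    smECE σ h D ≤ smECE τ h D + 2 * (τ / σ - 1) := by
  have hτ : 0 < τ := hσ.trans_le hστ
  have hr : 0 ≤ τ / σ - 1 := by
    rw [sub_nonneg, one_le_div hσ]
    exact hστ
  have hFm (ρ : ℝ) : Measurable fun t => ∫ p, gaussianKernel ρ t (h p.1) * residual p ∂D :=
    (measurable_gaussianKernel_mul_residual hh ρ).stronglyMeasurable.integral_prod_right.measurable
  rw [← ENNReal.ofReal_le_ofReal_iff (add_nonneg (smECE_nonneg τ) (by positivity)),
    ENNReal.ofReal_add (smECE_nonneg τ) (by positivity), ofReal_smECE hh hσ, ofReal_smECE hh hτ]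
  calc _ ≤ ∫⁻ t, (ENNReal.ofReal |∫ p, gaussianKernel τ t (h p.1) * residual p ∂D| +
          ENNReal.ofReal |∫ p, (gaussianKernel σ t (h p.1) - gaussianKernel τ t (h p.1)) *
            residual p ∂D|) := by
        refine lintegral_mono fun t => ?_
        rw [← ENNReal.ofReal_add (abs_nonneg _) (abs_nonneg _)]
        refine ENNReal.ofReal_le_ofReal ?_
        simp_rw [sub_mul]
        rw [integral_sub (integrable_gaussianKernel_mul_residual hh σ t)
          (integrable_gaussianKernel_mul_residual hh τ t)]
        refine le_trans (le_of_eq ?_) (abs_add_le _ _)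
        congr 1
        ring
    _ ≤ _ := by
        rw [lintegral_add_left ((hFm τ).abs.ennreal_ofReal)]
        gcongr
        refine (lintegral_abs_integral_le (by unfold Function.uncurry; fun_prop)).trans ?_
        refine (lintegral_mono (g := fun _ => ENNReal.ofReal (2 * (τ / σ - 1)))
          fun p => ?_).trans (by simp)
        refine (lintegral_mono fun t => ENNReal.ofReal_le_ofReal ?_).trans
          (lintegral_abs_gaussianKernel_scale_sub_le hσ hστ (h p.1))
        rw [abs_mul]
        exact mul_le_of_le_one_right (abs_nonneg _) (abs_residual_le_one p)

lemma continuousOn_smECE (hh : Measurable h) :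
    ContinuousOn (fun σ => smECE σ h D) (Set.Ioi 0) := by
  intro σ hσ
  have hσ' : (0 : ℝ) < σ := hσ
  refine ContinuousAt.continuousWithinAt ?_
  rw [ContinuousAt, tendsto_iff_dist_tendsto_zero]
  have hlim : Filter.Tendsto (fun τ => 2 * (max τ σ / min τ σ - 1)) (nhds σ) (nhds 0) := by
    have : ContinuousAt (fun τ => 2 * (max τ σ / min τ σ - 1)) σ := by
      have : min σ σ ≠ 0 := by simpa using hσ'.ne'
      fun_prop (disch := assumption)
    simpa [ContinuousAt, div_self hσ'.ne'] using this
  refine squeeze_zero' (Filter.Eventually.of_forall fun _ => dist_nonneg) ?_ hlim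
  filter_upwards [lt_mem_nhds hσ'] with τ hτ
  rw [Real.dist_eq]
  rcases le_total σ τ with h1 | h1
  · rw [max_eq_left h1, min_eq_right h1, abs_sub_comm,
      abs_of_nonneg (sub_nonneg.2 (smECE_antitone hh hσ' h1))]
    linarith [smECE_le_add (D := D) hh hσ' h1]
  · rw [max_eq_right h1, min_eq_left h1,
      abs_of_nonneg (sub_nonneg.2 (smECE_antitone hh hτ h1))]
    linarith [smECE_le_add (D := D) hh hτ h1]

/-- The fixed point exists by the intermediate value theorem and is unique by monotonicity. -/
lemma existsUnique_isSmECEStar (hh : Measurable h) : ∃! σ : ℝ, IsSmECEStar h D σ := by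
  -- the fixed point is zero exactly if `smECE` vanishes at every scale
  by_cases hz : ∀ τ : ℝ, 0 < τ → smECE τ h D = 0
  · refine ⟨0, Or.inr ⟨rfl, hz⟩, ?_⟩
    rintro σ (⟨hσ, hfix⟩ | ⟨h0, -⟩)
    · rw [← hfix, hz σ hσ]
    · exact h0
  push Not at hz
  obtain ⟨τ, hτ, hne⟩ := hz
  have hs : 0 < smECE τ h D := (smECE_nonneg τ).lt_of_ne' hne
  -- below `ε` the function `smECE` exceeds its argument
  set ε := min τ (smECE τ h D) with hε
  have hε0 : 0 < ε := lt_min hτ hs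
  have hε1 : ε ≤ 1 := (min_le_right _ _).trans (smECE_le_one hh hτ)
  have hεs : ε ≤ smECE ε h D :=
    (min_le_right _ _).trans (smECE_antitone hh hε0 (min_le_left _ _))
  have hcont : ContinuousOn (fun σ => smECE σ h D - σ) (Set.Icc ε 1) :=
    ((continuousOn_smECE hh).mono fun x hx => hε0.trans_le hx.1).sub continuousOn_id
  obtain ⟨σ, hσ, hfix⟩ := intermediate_value_Icc' hε1 hcont
    ⟨sub_nonpos.2 (smECE_le_one hh one_pos), sub_nonneg.2 hεs⟩
  have hσ0 : 0 < σ := hε0.trans_le hσ.1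
  have hfix' : smECE σ h D = σ := sub_eq_zero.1 hfix
  refine ⟨σ, Or.inl ⟨hσ0, hfix'⟩, ?_⟩
  rintro σ' (⟨hσ'0, hfix''⟩ | ⟨-, hvan⟩)
  · rcases le_total σ σ' with hle | hle
    · have := smECE_antitone (D := D) hh hσ0 hle
      linarith
    · have := smECE_antitone (D := D) hh hσ'0 hle
      linarith
  · exact absurd (hvan τ hτ) hne

end

/-! ### The smoothed calibration error is bounded by the distance to calibration -/

lemma integral_gaussianKernel_mul_residual_eq_zero {h : unitInterval → EReal} (hh : Measurable h)
    {D : Measure Sample} [IsProbabilityMeasure D] (hD : PerfectlyCalibrated D) (σ t : ℝ) :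
    ∫ p, gaussianKernel σ t (h p.1) * residual p ∂D = 0 := by
  have hm : MeasurableSpace.comap (Prod.fst : Sample → unitInterval) inferInstance ≤
      (inferInstance : MeasurableSpace Sample) := measurable_fst.comap_le
  have hg : StronglyMeasurable[MeasurableSpace.comap (Prod.fst : Sample → unitInterval)
      inferInstance] fun p : Sample => gaussianKernel σ t (h p.1) := by
    have h1 : Measurable fun u : unitInterval => gaussianKernel σ t (h u) := by fun_prop
    exact (h1.comp (comap_measurable Prod.fst)).stronglyMeasurable
  have hb (p : Sample) : |gaussianKernel σ t (h p.1)| ≤ (√(2 * Real.pi * σ ^ 2))⁻¹ := by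
    rw [abs_of_nonneg (gaussianKernel_nonneg _ _ _)]
    exact gaussianKernel_le _ _ _
  have hout : Integrable (fun p : Sample => outcome p.2) D := by
    refine Integrable.of_bound
      (measurable_outcome.comp measurable_snd).aestronglyMeasurable 1
      (Filter.Eventually.of_forall fun p => ?_)
    cases p.2 <;> simp [outcome]
  have hgo : Integrable (fun p : Sample => gaussianKernel σ t (h p.1) * outcome p.2) D :=
    hout.bdd_mul (hg.mono hm).aestronglyMeasurable (Filter.Eventually.of_forall hb)
  have hgf : Integrable (fun p : Sample => gaussianKernel σ t (h p.1) * (p.1 : ℝ)) D := by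
    refine (integrable_gaussianKernel_mul_residual hh σ t |>.add hgo).congr
      (Filter.Eventually.of_forall fun p => ?_)
    simp only [Pi.add_apply, residual]
    ring
  have hcond : ∫ p, gaussianKernel σ t (h p.1) * outcome p.2 ∂D =
      ∫ p, gaussianKernel σ t (h p.1) * (p.1 : ℝ) ∂D := by
    rw [← integral_condExp hm]
    refine integral_congr_ae ?_
    filter_upwards [condExp_mul_of_stronglyMeasurable_left hg hgo hout, hD] with p hp hp'
    have : (fun p : Sample => gaussianKernel σ t (h p.1) * outcome p.2) =
      (fun p : Sample => gaussianKernel σ t (h p.1)) * fun p : Sample => outcome p.2 := rfl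
    rw [this, hp, Pi.mul_apply, hp']
  simp_rw [residual, mul_sub]
  rw [integral_sub hgf hgo, hcond, sub_self]

/-- The kernel `φ_σ(· - h(f)) (f - y)` is, as a map from samples to `L¹`, Lipschitz for the ground
distance, provided that `L d_h` dominates the distance on `[0, 1]`. -/
lemma lintegral_abs_gaussianKernel_mul_residual_sub_le {h : unitInterval → EReal}
    {L : ℝ} (hL : 0 < L)
    (hlip : ∀ u v : unitInterval, ENNReal.ofReal |(u : ℝ) - (v : ℝ)| ≤
      ENNReal.ofReal L * inducedDist h u v) {σ : ℝ} (hσ : 0 < σ) (p q : Sample) :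
    ∫⁻ t, ENNReal.ofReal |gaussianKernel σ t (h p.1) * residual p -
        gaussianKernel σ t (h q.1) * residual q| ≤
      ENNReal.ofReal (L + 2 + 1 / σ) * sampleDist (inducedDist h) p q := by
  have hσi : 0 < 1 / σ := one_div_pos.2 hσ
  have hone : 1 ≤ ENNReal.ofReal (L + 2 + 1 / σ) := by
    rw [ENNReal.one_le_ofReal]
    linarith
  have hres : |residual p - residual q| ≤
      |(p.1 : ℝ) - (q.1 : ℝ)| + |outcome p.2 - outcome q.2| := by
    refine le_trans (le_of_eq ?_) (abs_sub _ _)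
    congr 1
    simp only [residual]
    ring
  have hpt (t : ℝ) : ENNReal.ofReal |gaussianKernel σ t (h p.1) * residual p -
        gaussianKernel σ t (h q.1) * residual q| ≤
      ENNReal.ofReal (|(p.1 : ℝ) - (q.1 : ℝ)| + |outcome p.2 - outcome q.2|) *
        ENNReal.ofReal (gaussianKernel σ t (h p.1)) +
      ENNReal.ofReal |gaussianKernel σ t (h p.1) - gaussianKernel σ t (h q.1)| := by
    rw [← ENNReal.ofReal_mul (by positivity),
      ← ENNReal.ofReal_add (mul_nonneg (by positivity) (gaussianKernel_nonneg _ _ _))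
        (abs_nonneg _)]
    refine ENNReal.ofReal_le_ofReal ?_
    have hsplit : gaussianKernel σ t (h p.1) * residual p -
        gaussianKernel σ t (h q.1) * residual q =
        (residual p - residual q) * gaussianKernel σ t (h p.1) +
        (gaussianKernel σ t (h p.1) - gaussianKernel σ t (h q.1)) * residual q := by ring
    rw [hsplit]
    refine (abs_add_le _ _).trans ?_
    rw [abs_mul, abs_mul, abs_of_nonneg (gaussianKernel_nonneg σ t (h p.1))]
    exact add_le_add (mul_le_mul_of_nonneg_right hres (gaussianKernel_nonneg _ _ _))
      (mul_le_of_le_one_right (abs_nonneg _) (abs_residual_le_one q))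
  set d := inducedDist h p.1 q.1 with hd
  set e := ENNReal.ofReal |outcome p.2 - outcome q.2| with he
  calc _ ≤ ENNReal.ofReal (|(p.1 : ℝ) - (q.1 : ℝ)| + |outcome p.2 - outcome q.2|) * 1 +
        ENNReal.ofReal (1 + 1 / σ) * d := by
        refine (lintegral_mono hpt).trans ?_
        rw [lintegral_add_left (by fun_prop), lintegral_const_mul _ (by fun_prop)]
        gcongr
        · exact lintegral_gaussianKernel_le_one hσ _
        · exact lintegral_abs_gaussianKernel_sub_le hσ _ _
    _ ≤ (ENNReal.ofReal L * d + e) + ENNReal.ofReal (1 + 1 / σ) * d := by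
        rw [mul_one, ENNReal.ofReal_add (abs_nonneg _) (abs_nonneg _)]
        gcongr
        exact hlip _ _
    _ = ENNReal.ofReal (L + (1 + 1 / σ)) * d + 1 * e := by
        rw [ENNReal.ofReal_add hL.le (by positivity)]
        ring
    _ ≤ ENNReal.ofReal (L + 2 + 1 / σ) * d + ENNReal.ofReal (L + 2 + 1 / σ) * e := by
        exact add_le_add (mul_le_mul_left (ENNReal.ofReal_le_ofReal (by linarith)) _)
          (mul_le_mul_left hone _)
    _ = _ := by rw [← mul_add]; rfl

lemma ofReal_smECE_le_of_mem_couplings {h : unitInterval → EReal} (hh : Measurable h)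
    {L : ℝ} (hL : 0 < L)
    (hlip : ∀ u v : unitInterval, ENNReal.ofReal |(u : ℝ) - (v : ℝ)| ≤
      ENNReal.ofReal L * inducedDist h u v) {D D' : Measure Sample} [IsProbabilityMeasure D]
    [IsProbabilityMeasure D'] (hcal : PerfectlyCalibrated D') {γ : Measure (Sample × Sample)}
    (hγ : γ ∈ Couplings D D') {σ : ℝ} (hσ : 0 < σ) :
    ENNReal.ofReal (smECE σ h D) ≤
      ENNReal.ofReal (L + 2 + 1 / σ) * ∫⁻ z, sampleDist (inducedDist h) z.1 z.2 ∂γ := by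
  obtain ⟨hfst, hsnd⟩ := hγ
  rw [ofReal_smECE hh hσ]
  have : IsProbabilityMeasure γ :=
    ⟨by rw [← Set.preimage_univ (f := Prod.fst), ← Measure.map_apply measurable_fst .univ, hfst,
      measure_univ]⟩
  have hF (t : ℝ) : ∫ p, gaussianKernel σ t (h p.1) * residual p ∂D =
      ∫ z, (gaussianKernel σ t (h z.1.1) * residual z.1 -
        gaussianKernel σ t (h z.2.1) * residual z.2) ∂γ := by
    let ψ : Sample → ℝ := fun p => gaussianKernel σ t (h p.1) * residual p
    have hψm : Measurable ψ := by fun_prop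
    have i1 : Integrable (fun z : Sample × Sample => ψ z.1) γ := by
      have : Integrable ψ (γ.map Prod.fst) := by
        rw [hfst]
        exact integrable_gaussianKernel_mul_residual hh σ t
      exact this.comp_measurable measurable_fst
    have i2 : Integrable (fun z : Sample × Sample => ψ z.2) γ := by
      have : Integrable ψ (γ.map Prod.snd) := by
        rw [hsnd]
        exact integrable_gaussianKernel_mul_residual hh σ t
      exact this.comp_measurable measurable_snd
    -- the calibrated marginal contributes nothing to the smoothed residual
    calc ∫ p, ψ p ∂D = ∫ p, ψ p ∂D - ∫ p, ψ p ∂D' := by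
          rw [integral_gaussianKernel_mul_residual_eq_zero hh hcal, sub_zero]
      _ = ∫ z, ψ z.1 ∂γ - ∫ z, ψ z.2 ∂γ := by
          rw [← hfst, ← hsnd,
            integral_map measurable_fst.aemeasurable hψm.aestronglyMeasurable,
            integral_map measurable_snd.aemeasurable hψm.aestronglyMeasurable]
      _ = _ := (integral_sub i1 i2).symm
  simp_rw [hF]
  refine (lintegral_abs_integral_le (by unfold Function.uncurry; fun_prop)).trans ?_
  rw [← lintegral_const_mul' _ _ ENNReal.ofReal_ne_top]
  exact lintegral_mono fun z =>
    lintegral_abs_gaussianKernel_mul_residual_sub_le hL hlip hσ z.1 z.2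

lemma ofReal_smECE_le_mul_dCE {h : unitInterval → EReal} (hh : Measurable h)
    {L : ℝ} (hL : 0 < L)
    (hlip : ∀ u v : unitInterval, ENNReal.ofReal |(u : ℝ) - (v : ℝ)| ≤
      ENNReal.ofReal L * inducedDist h u v) {D : Measure Sample} [IsProbabilityMeasure D]
    {σ : ℝ} (hσ : 0 < σ) :
    ENNReal.ofReal (smECE σ h D) ≤
      ENNReal.ofReal (L + 2 + 1 / σ) * dCE (inducedDist h) D := by
  have hpos : 0 < L + 2 + 1 / σ := by positivity
  have hc0 : ENNReal.ofReal (L + 2 + 1 / σ) ≠ 0 := (ENNReal.ofReal_pos.2 hpos).ne'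
  rw [← ENNReal.inv_mul_le_iff hc0 ENNReal.ofReal_ne_top]
  unfold dCE wasserstein
  refine le_iInf₂ fun D' hD' => le_iInf₂ fun γ hγ => ?_
  have := hD'.1
  rw [ENNReal.inv_mul_le_iff hc0 ENNReal.ofReal_ne_top]
  exact ofReal_smECE_le_of_mem_couplings hh hL hlip hD'.2 hγ hσ

/-- At a fixed point `σ` the bound `σ ≤ (L + 2 + 1 / σ) dCE` becomes `σ ^ 2 ≤ (L + 3) dCE`. -/
lemma IsSmECEStar.le_sqrt_mul_dCE {h : unitInterval → EReal} (hh : Measurable h)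
    {L : ℝ} (hL : 0 < L)
    (hlip : ∀ u v : unitInterval, ENNReal.ofReal |(u : ℝ) - (v : ℝ)| ≤
      ENNReal.ofReal L * inducedDist h u v) {D : Measure Sample} [IsProbabilityMeasure D]
    {σ : ℝ} (hσ : IsSmECEStar h D σ) :
    ENNReal.ofReal σ ≤
      ENNReal.ofReal (√(L + 3)) * dCE (inducedDist h) D ^ (1 / 2 : ℝ) := by
  rcases hσ with ⟨hpos, hfix⟩ | ⟨rfl, -⟩
  · have hle : σ ≤ 1 := hfix ▸ smECE_le_one hh hpos
    have h1 := ofReal_smECE_le_mul_dCE (D := D) hh hL hlip hpos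
    rw [hfix] at h1
    have h2 : ENNReal.ofReal σ ^ (2 : ℝ) ≤ ENNReal.ofReal (L + 3) * dCE (inducedDist h) D := by
      calc ENNReal.ofReal σ ^ (2 : ℝ) = ENNReal.ofReal σ * ENNReal.ofReal σ := by
            rw [ENNReal.rpow_two, sq]
        _ ≤ ENNReal.ofReal σ * (ENNReal.ofReal (L + 2 + 1 / σ) * dCE (inducedDist h) D) := by
            gcongr
        _ = ENNReal.ofReal (σ * (L + 2 + 1 / σ)) * dCE (inducedDist h) D := by
            rw [ENNReal.ofReal_mul hpos.le, mul_assoc]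
        _ ≤ _ := by
            gcongr
            rw [mul_add, mul_one_div_cancel hpos.ne']
            nlinarith
    have h3 := ENNReal.rpow_le_rpow h2 (z := 1 / 2) (by norm_num)
    rwa [← ENNReal.rpow_mul, mul_one_div_cancel two_ne_zero, ENNReal.rpow_one,
      ENNReal.mul_rpow_of_nonneg _ _ (by norm_num),
      ENNReal.ofReal_rpow_of_nonneg (by positivity) (by norm_num), ← Real.sqrt_eq_rpow] at h3
  · simp

/-! ### Matching two measures through their smoothings -/

section Matching

variable {X T : Type*} [MeasurableSpace X] [MeasurableSpace T]

/-- The density at `t` of the smoothing of the measure `A` by the kernel `k`. -/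
noncomputable def smoothing (k : T → X → ℝ≥0∞) (A : Measure X) (t : T) : ℝ≥0∞ := ∫⁻ x, k t x ∂A

/-- The density with respect to `A × B` of the following partial coupling of `A` and `B`: the
common part `min(a, b)` of the densities `a`, `b` of the smoothings of `A` and `B` is carried back
along `k`, independently to `A` and to `B`. As `min(a, b) / (a b) = 1 / max(a, b)`, this density is
`∫ k(t, x) k(t, y) / max(a(t), b(t)) dt`. -/
noncomputable def matchingDensity (τ : Measure T) (k : T → X → ℝ≥0∞) (A B : Measure X) (x y : X) :
    ℝ≥0∞ :=
  ∫⁻ t, k t x * k t y * (max (smoothing k A t) (smoothing k B t))⁻¹ ∂τ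

variable {τ : Measure T} {k : T → X → ℝ≥0∞} {A B : Measure X}

lemma matchingDensity_comm (x y : X) :
    matchingDensity τ k A B x y = matchingDensity τ k B A y x := by
  unfold matchingDensity
  refine lintegral_congr fun t => ?_
  rw [mul_comm (k t x), max_comm]

lemma mul_inv_max_le_one (a b : ℝ≥0∞) : b * (max a b)⁻¹ ≤ 1 := by
  rw [← div_eq_mul_inv]
  exact ENNReal.div_le_of_le_mul (by rw [one_mul]; exact le_max_right _ _)

lemma sub_mul_mul_inv_max_le {a b : ℝ≥0∞} (ha : a ≠ ∞) (hb : b ≠ ∞) :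
    a - a * (b * (max a b)⁻¹) ≤ a - b := by
  rcases le_total a b with h | h
  · rcases eq_or_ne b 0 with rfl | hb0
    · simp
    · rw [max_eq_right h, ENNReal.mul_inv_cancel hb0 hb, mul_one, tsub_self]
      exact zero_le
  · rcases eq_or_ne a 0 with rfl | ha0
    · simp
    · rw [max_eq_left h, mul_comm b, ← mul_assoc, ENNReal.mul_inv_cancel ha0 ha, one_mul]

variable [IsFiniteMeasure A] [IsFiniteMeasure B]

lemma measurable_smoothing (hk : Measurable (Function.uncurry k)) (A : Measure X) [SFinite A] :
    Measurable (smoothing k A) :=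
  hk.lintegral_prod_right'

lemma measurable_matchingIntegrand (hk : Measurable (Function.uncurry k)) :
    Measurable fun z : (X × X) × T => k z.2 z.1.1 * k z.2 z.1.2 *
      (max (smoothing k A z.2) (smoothing k B z.2))⁻¹ := by
  have h1 : Measurable fun z : (X × X) × T => k z.2 z.1.1 :=
    hk.comp (measurable_snd.prodMk (measurable_fst.comp measurable_fst))
  have h2 : Measurable fun z : (X × X) × T => k z.2 z.1.2 :=
    hk.comp (measurable_snd.prodMk (measurable_snd.comp measurable_fst))
  have ha : Measurable fun z : (X × X) × T => smoothing k A z.2 :=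
    (measurable_smoothing hk A).comp measurable_snd
  have hb : Measurable fun z : (X × X) × T => smoothing k B z.2 :=
    (measurable_smoothing hk B).comp measurable_snd
  exact (h1.mul h2).mul (ha.max hb).inv

lemma measurable_matchingDensity [SFinite τ] (hk : Measurable (Function.uncurry k)) :
    Measurable fun z : X × X => matchingDensity τ k A B z.1 z.2 :=
  (measurable_matchingIntegrand hk).lintegral_prod_right'

/-- Integrating out the second point of the partial coupling replaces `k(t, y)` by the density
`b(t)` of the smoothing of `B`. -/
lemma lintegral_mul_matchingIntegrand [SFinite τ] (hk : Measurable (Function.uncurry k))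
    {φ : T → ℝ≥0∞} (hφ : Measurable φ) (x : X) :
    ∫⁻ y, ∫⁻ t, φ t * (k t x * k t y * (max (smoothing k A t) (smoothing k B t))⁻¹) ∂τ ∂B =
      ∫⁻ t, φ t * k t x * (smoothing k B t * (max (smoothing k A t) (smoothing k B t))⁻¹) ∂τ := by
  have hm : Measurable fun z : X × T =>
      φ z.2 * (k z.2 x * k z.2 z.1 * (max (smoothing k A z.2) (smoothing k B z.2))⁻¹) :=
    (hφ.comp measurable_snd).mul ((measurable_matchingIntegrand (A := A) (B := B) hk).comp
      (g := fun z : (X × X) × T => k z.2 z.1.1 * k z.2 z.1.2 *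
        (max (smoothing k A z.2) (smoothing k B z.2))⁻¹)
      (f := fun z : X × T => ((x, z.1), z.2))
      ((measurable_const.prodMk measurable_fst).prodMk measurable_snd))
  rw [lintegral_lintegral_swap hm.aemeasurable]
  refine lintegral_congr fun t => ?_
  have hkt : Measurable (k t) := hk.comp (measurable_const.prodMk measurable_id)
  calc ∫⁻ y, φ t * (k t x * k t y * (max (smoothing k A t) (smoothing k B t))⁻¹) ∂B
      = ∫⁻ y, (φ t * k t x * (max (smoothing k A t) (smoothing k B t))⁻¹) * k t y ∂B :=
        lintegral_congr fun y => by ring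
    _ = (φ t * k t x * (max (smoothing k A t) (smoothing k B t))⁻¹) * smoothing k B t :=
        lintegral_const_mul _ hkt
    _ = _ := by ring

lemma lintegral_matchingDensity [SFinite τ] (hk : Measurable (Function.uncurry k)) (x : X) :
    ∫⁻ y, matchingDensity τ k A B x y ∂B =
      ∫⁻ t, k t x * (smoothing k B t * (max (smoothing k A t) (smoothing k B t))⁻¹) ∂τ := by
  simpa [matchingDensity] using lintegral_mul_matchingIntegrand (τ := τ) (A := A) (B := B) hk
    (measurable_const (a := 1)) x

lemma lintegral_matchingDensity_le_one [SFinite τ] (hk : Measurable (Function.uncurry k))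
    (hk1 : ∀ x, ∫⁻ t, k t x ∂τ ≤ 1) (x : X) : ∫⁻ y, matchingDensity τ k A B x y ∂B ≤ 1 := by
  rw [lintegral_matchingDensity hk]
  exact (lintegral_mono fun t => mul_le_of_le_one_right' (mul_inv_max_le_one _ _)).trans (hk1 x)

/-- The part of `A` left over by the partial coupling has mass `∫ (a - b)⁺`. -/
lemma lintegral_one_sub_lintegral_matchingDensity_le [SFinite τ]
    (hk : Measurable (Function.uncurry k)) (hk1 : ∀ x, ∫⁻ t, k t x ∂τ ≤ 1)
    (hkA : ∀ᵐ x ∂A, ∫⁻ t, k t x ∂τ = 1) (hA : ∀ t, smoothing k A t ≠ ∞)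
    (hB : ∀ t, smoothing k B t ≠ ∞) :
    ∫⁻ x, (1 - ∫⁻ y, matchingDensity τ k A B x y ∂B) ∂A ≤
      ∫⁻ t, (smoothing k A t - smoothing k B t) ∂τ := by
  have hw : Measurable fun x => ∫⁻ y, matchingDensity τ k A B x y ∂B :=
    (measurable_matchingDensity hk).lintegral_prod_right'
  have hle := lintegral_matchingDensity_le_one (A := A) (B := B) hk hk1
  have hfin : ∫⁻ x, ∫⁻ y, matchingDensity τ k A B x y ∂B ∂A ≠ ∞ :=
    ((lintegral_mono hle).trans_lt (by simp [measure_lt_top])).ne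
  have ha := measurable_smoothing hk A
  have hb := measurable_smoothing hk B
  have hmass : ∫⁻ _, 1 ∂A = ∫⁻ t, smoothing k A t ∂τ := by
    unfold smoothing
    rw [lintegral_lintegral_swap hk.aemeasurable]
    exact lintegral_congr_ae (hkA.mono fun x hx => hx.symm)
  have hcommon : ∫⁻ x, ∫⁻ y, matchingDensity τ k A B x y ∂B ∂A =
      ∫⁻ t, smoothing k A t *
        (smoothing k B t * (max (smoothing k A t) (smoothing k B t))⁻¹) ∂τ := by
    simp_rw [lintegral_matchingDensity hk]
    rw [lintegral_lintegral_swap]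
    · refine lintegral_congr fun t => ?_
      exact lintegral_mul_const _ (hk.comp (measurable_const.prodMk measurable_id))
    · refine Measurable.aemeasurable (Measurable.mul ?_ ?_)
      · exact hk.comp measurable_swap
      · exact (hb.mul (ha.max hb).inv).comp measurable_snd
  have hm : Measurable fun t => smoothing k A t *
      (smoothing k B t * (max (smoothing k A t) (smoothing k B t))⁻¹) :=
    ha.mul (hb.mul (ha.max hb).inv)
  rw [lintegral_sub hw hfin (Filter.Eventually.of_forall hle), hmass, hcommon,
    ← lintegral_sub hm (hcommon ▸ hfin)
      (Filter.Eventually.of_forall fun t => mul_le_of_le_one_right' (mul_inv_max_le_one _ _))]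
  exact lintegral_mono fun t => sub_mul_mul_inv_max_le (hA t) (hB t)

/-- A cost that depends only on the first point and on `t` is at most its integral over all of
`A`. -/
lemma lintegral_lintegral_mul_matchingIntegrand_le [SFinite τ]
    (hk : Measurable (Function.uncurry k)) {φ : T → X → ℝ≥0∞}
    (hφ : Measurable (Function.uncurry φ)) :
    ∫⁻ x, ∫⁻ y, ∫⁻ t, φ t x *
        (k t x * k t y * (max (smoothing k A t) (smoothing k B t))⁻¹) ∂τ ∂B ∂A ≤
      ∫⁻ x, ∫⁻ t, φ t x * k t x ∂τ ∂A := by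
  refine lintegral_mono fun x => ?_
  have hφx : Measurable fun t => φ t x := hφ.comp (measurable_id.prodMk measurable_const)
  rw [lintegral_mul_matchingIntegrand hk hφx]
  exact lintegral_mono fun t => mul_le_of_le_one_right' (mul_inv_max_le_one _ _)

/-- Two finite measures have a partial coupling which leaves out no more mass than the `L¹`
distance of their smoothings, and which transports no further than smoothing does: going from `x`
to `y` costs at most a move from `x` to some `t` and a move from `t` to `y`. -/
lemma exists_partial_coupling [SFinite τ] (hk : Measurable (Function.uncurry k))
    (hk1 : ∀ x, ∫⁻ t, k t x ∂τ ≤ 1) (hkA : ∀ᵐ x ∂A, ∫⁻ t, k t x ∂τ = 1)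
    (hkB : ∀ᵐ x ∂B, ∫⁻ t, k t x ∂τ = 1) (hA : ∀ t, smoothing k A t ≠ ∞)
    (hB : ∀ t, smoothing k B t ≠ ∞) {φ : T → X → ℝ≥0∞} (hφ : Measurable (Function.uncurry φ))
    {c : X × X → ℝ≥0∞} (hc : Measurable c) (hcφ : ∀ t x y, c (x, y) ≤ φ t x + φ t y) :
    ∃ (γ : Measure (X × X)) (u v : X → ℝ≥0∞), γ ≪ A.prod B ∧
      Measurable u ∧ (∀ x, u x ≤ 1) ∧ γ.map Prod.fst = A.withDensity u ∧
      Measurable v ∧ (∀ x, v x ≤ 1) ∧ γ.map Prod.snd = B.withDensity v ∧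
      ∫⁻ x, (1 - u x) ∂A ≤ ∫⁻ t, (smoothing k A t - smoothing k B t) ∂τ ∧
      ∫⁻ x, (1 - v x) ∂B ≤ ∫⁻ t, (smoothing k B t - smoothing k A t) ∂τ ∧
      ∫⁻ z, c z ∂γ ≤ ∫⁻ x, ∫⁻ t, φ t x * k t x ∂τ ∂A + ∫⁻ x, ∫⁻ t, φ t x * k t x ∂τ ∂B := by
  have hw := measurable_matchingDensity (τ := τ) (A := A) (B := B) hk
  have hw' := measurable_matchingDensity (τ := τ) (A := B) (B := A) hk
  refine ⟨(A.prod B).withDensity fun z => matchingDensity τ k A B z.1 z.2,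
    fun x => ∫⁻ y, matchingDensity τ k A B x y ∂B,
    fun y => ∫⁻ x, matchingDensity τ k B A y x ∂A,
    withDensity_absolutelyContinuous _ _, hw.lintegral_prod_right',
    lintegral_matchingDensity_le_one hk hk1, ?_, hw'.lintegral_prod_right',
    lintegral_matchingDensity_le_one hk hk1, ?_,
    lintegral_one_sub_lintegral_matchingDensity_le hk hk1 hkA hA hB,
    lintegral_one_sub_lintegral_matchingDensity_le hk hk1 hkB hB hA, ?_⟩
  · ext s hs
    rw [Measure.map_apply measurable_fst hs, withDensity_apply _ (measurable_fst hs),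
      withDensity_apply _ hs, ← Set.prod_univ, setLIntegral_prod _ hw.aemeasurable,
      Measure.restrict_univ]
  · ext s hs
    simp_rw [← matchingDensity_comm (A := A) (B := B)]
    rw [Measure.map_apply measurable_snd hs, withDensity_apply _ (measurable_snd hs),
      withDensity_apply _ hs, ← Set.univ_prod, ← Measure.prod_restrict, Measure.restrict_univ,
      lintegral_prod_symm _ hw.aemeasurable]
  · have hI := measurable_matchingIntegrand (A := A) (B := B) hk
    have hφ1 : Measurable fun z : (X × X) × T => φ z.2 z.1.1 :=
      hφ.comp (measurable_snd.prodMk (measurable_fst.comp measurable_fst))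
    have hφ2 : Measurable fun z : (X × X) × T => φ z.2 z.1.2 :=
      hφ.comp (measurable_snd.prodMk (measurable_snd.comp measurable_fst))
    have h1 : Measurable fun z : (X × X) × T => φ z.2 z.1.1 * (k z.2 z.1.1 * k z.2 z.1.2 *
        (max (smoothing k A z.2) (smoothing k B z.2))⁻¹) := hφ1.mul hI
    have h2 : Measurable fun z : (X × X) × T => φ z.2 z.1.2 * (k z.2 z.1.1 * k z.2 z.1.2 *
        (max (smoothing k A z.2) (smoothing k B z.2))⁻¹) := hφ2.mul hI
    rw [lintegral_withDensity_eq_lintegral_mul _ hw hc]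
    calc ∫⁻ z, matchingDensity τ k A B z.1 z.2 * c z ∂(A.prod B)
        ≤ ∫⁻ z, (∫⁻ t, φ t z.1 * (k t z.1 * k t z.2 *
              (max (smoothing k A t) (smoothing k B t))⁻¹) ∂τ +
            ∫⁻ t, φ t z.2 * (k t z.1 * k t z.2 *
              (max (smoothing k A t) (smoothing k B t))⁻¹) ∂τ) ∂(A.prod B) := by
          refine lintegral_mono fun z => ?_
          have h1z : Measurable fun t => φ t z.1 * (k t z.1 * k t z.2 *
              (max (smoothing k A t) (smoothing k B t))⁻¹) := h1.comp measurable_prodMk_left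
          rw [← lintegral_add_left h1z, mul_comm]
          refine (lintegral_const_mul_le _ _).trans (lintegral_mono fun t => ?_)
          rw [← add_mul]
          exact mul_le_mul_left (hcφ t z.1 z.2) _
      _ ≤ _ := by
          have h1' : Measurable fun z : X × X => ∫⁻ t, φ t z.1 * (k t z.1 * k t z.2 *
              (max (smoothing k A t) (smoothing k B t))⁻¹) ∂τ := h1.lintegral_prod_right'
          have h2' : Measurable fun z : X × X => ∫⁻ t, φ t z.2 * (k t z.1 * k t z.2 *
              (max (smoothing k A t) (smoothing k B t))⁻¹) ∂τ := h2.lintegral_prod_right'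
          rw [lintegral_add_left h1']
          refine add_le_add ?_ ?_
          · rw [lintegral_prod _ h1'.aemeasurable]
            exact lintegral_lintegral_mul_matchingIntegrand_le hk hφ
          · rw [lintegral_prod_symm _ h2'.aemeasurable]
            refine le_trans (le_of_eq ?_)
              (lintegral_lintegral_mul_matchingIntegrand_le (A := B) (B := A) hk hφ)
            refine lintegral_congr fun y => lintegral_congr fun x => lintegral_congr fun t => ?_
            rw [mul_comm (k t x), max_comm]

end Matching

/-! ### Recalibration by resampling the outcomes -/

/-- The sample with the same prediction and the opposite outcome. -/
def flipLabel (p : Sample) : Sample := (p.1, !p.2)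

/-- The distribution obtained from `D` by keeping the prediction `f` and replacing the outcome by
an independent Bernoulli variable with mean `f`. The new outcome differs from `y` with conditional
probability `|f - y|`. -/
noncomputable def recalibrated (D : Measure Sample) : Measure Sample :=
  D.withDensity (fun p => 1 - ENNReal.ofReal |residual p|) +
    (D.withDensity fun p => ENNReal.ofReal |residual p|).map flipLabel

@[fun_prop]
lemma measurable_flipLabel : Measurable flipLabel :=
  measurable_fst.prodMk ((measurable_of_finite Bool.not).comp measurable_snd)

lemma ofReal_abs_residual_le_one (p : Sample) : ENNReal.ofReal |residual p| ≤ 1 :=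
  ENNReal.ofReal_le_one.2 (abs_residual_le_one p)

lemma one_sub_ofReal_abs_residual (p : Sample) :
    1 - ENNReal.ofReal |residual p| = ENNReal.ofReal (1 - |residual p|) := by
  rw [ENNReal.ofReal_sub _ (abs_nonneg _), ENNReal.ofReal_one]

section

variable {D : Measure Sample}

lemma lintegral_recalibrated {g : Sample → ℝ≥0∞} (hg : Measurable g) :
    ∫⁻ p, g p ∂(recalibrated D) =
      ∫⁻ p, ((1 - ENNReal.ofReal |residual p|) * g p +
        ENNReal.ofReal |residual p| * g (flipLabel p)) ∂D := by
  have h1 : Measurable fun p : Sample => 1 - ENNReal.ofReal |residual p| := by fun_prop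
  have h2 : Measurable fun p : Sample => ENNReal.ofReal |residual p| := by fun_prop
  have hgf : Measurable fun p => g (flipLabel p) := hg.comp measurable_flipLabel
  rw [recalibrated, lintegral_add_measure, lintegral_map hg measurable_flipLabel,
    lintegral_withDensity_eq_lintegral_mul _ h1 hg,
    lintegral_withDensity_eq_lintegral_mul _ h2 hgf,
    ← lintegral_add_left (h1.mul hg)]
  rfl

lemma lintegral_recalibrated_fst {g : unitInterval → ℝ≥0∞} (hg : Measurable g) :
    ∫⁻ p, g p.1 ∂(recalibrated D) = ∫⁻ p, g p.1 ∂D := by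
  rw [lintegral_recalibrated (g := fun p => g p.1) (hg.comp measurable_fst)]
  refine lintegral_congr fun p => ?_
  change (1 - ENNReal.ofReal |residual p|) * g p.1 + ENNReal.ofReal |residual p| * g p.1 = g p.1
  rw [← add_mul, tsub_add_cancel_of_le (ofReal_abs_residual_le_one p), one_mul]

instance [IsProbabilityMeasure D] : IsProbabilityMeasure (recalibrated D) :=
  ⟨by simpa using lintegral_recalibrated_fst (D := D) (measurable_const (a := 1))⟩

lemma mul_outcome_add_mul_outcome_flipLabel (p : Sample) :
    (1 - ENNReal.ofReal |residual p|) * ENNReal.ofReal (outcome p.2) +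
      ENNReal.ofReal |residual p| * ENNReal.ofReal (outcome (flipLabel p).2) =
        ENNReal.ofReal (p.1 : ℝ) := by
  obtain ⟨⟨f, h0, h1⟩, y⟩ := p
  rw [one_sub_ofReal_abs_residual]
  cases y
  · simp [residual, outcome, flipLabel, abs_of_nonneg h0]
  · simp [residual, outcome, flipLabel, abs_of_nonpos (sub_nonpos.2 h1)]

lemma lintegral_outcome_recalibrated {s : Set unitInterval} (hs : MeasurableSet s) :
    ∫⁻ p in Prod.fst ⁻¹' s, ENNReal.ofReal (outcome p.2) ∂(recalibrated D) =
      ∫⁻ p in Prod.fst ⁻¹' s, ENNReal.ofReal (p.1 : ℝ) ∂(recalibrated D) := by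
  have hs' : MeasurableSet (Prod.fst ⁻¹' s : Set Sample) := measurable_fst hs
  have ho : Measurable fun p : Sample => ENNReal.ofReal (outcome p.2) :=
    (measurable_outcome.comp measurable_snd).ennreal_ofReal
  have hf : Measurable fun u : unitInterval => ENNReal.ofReal (u : ℝ) :=
    measurable_subtype_coe.ennreal_ofReal
  have key (p : Sample) : (Prod.fst ⁻¹' s).indicator
      (fun p : Sample => ENNReal.ofReal (p.1 : ℝ)) p =
        s.indicator (fun u : unitInterval => ENNReal.ofReal (u : ℝ)) p.1 := rfl
  rw [← lintegral_indicator hs', ← lintegral_indicator hs']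
  simp_rw [key]
  rw [lintegral_recalibrated_fst (hf.indicator hs), lintegral_recalibrated (ho.indicator hs')]
  refine lintegral_congr fun p => ?_
  by_cases hp : p.1 ∈ s
  · rw [Set.indicator_of_mem (show p ∈ Prod.fst ⁻¹' s from hp),
      Set.indicator_of_mem (show flipLabel p ∈ Prod.fst ⁻¹' s from hp), Set.indicator_of_mem hp,
      mul_outcome_add_mul_outcome_flipLabel]
  · rw [Set.indicator_of_notMem (show p ∉ Prod.fst ⁻¹' s from hp),
      Set.indicator_of_notMem (show flipLabel p ∉ Prod.fst ⁻¹' s from hp),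
      Set.indicator_of_notMem hp, mul_zero, mul_zero, add_zero]

lemma perfectlyCalibrated_recalibrated [IsProbabilityMeasure D] :
    PerfectlyCalibrated (recalibrated D) := by
  have ho : Measurable fun p : Sample => outcome p.2 := measurable_outcome.comp measurable_snd
  have hf : Measurable fun p : Sample => (p.1 : ℝ) := measurable_subtype_coe.comp measurable_fst
  have ho0 (p : Sample) : 0 ≤ outcome p.2 := by cases p.2 <;> simp [outcome]
  have hio : Integrable (fun p : Sample => outcome p.2) (recalibrated D) := by
    refine Integrable.of_bound ho.aestronglyMeasurable 1 (Filter.Eventually.of_forall fun p => ?_)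
    cases p.2 <;> simp [outcome]
  have hif : Integrable (fun p : Sample => (p.1 : ℝ)) (recalibrated D) := by
    refine Integrable.of_bound hf.aestronglyMeasurable 1 (Filter.Eventually.of_forall fun p => ?_)
    rw [Real.norm_eq_abs, abs_of_nonneg p.1.2.1]
    exact p.1.2.2
  refine (ae_eq_condExp_of_forall_setIntegral_eq measurable_fst.comap_le hio
    (fun _ _ _ => hif.integrableOn) ?_ ?_).symm
  · rintro _ ⟨s, hs, rfl⟩ -
    rw [integral_eq_lintegral_of_nonneg_ae (Filter.Eventually.of_forall fun p => p.1.2.1)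
        hf.aestronglyMeasurable,
      integral_eq_lintegral_of_nonneg_ae (Filter.Eventually.of_forall ho0)
        ho.aestronglyMeasurable, lintegral_outcome_recalibrated hs]
  · exact (measurable_subtype_coe.comp
      (comap_measurable Prod.fst)).stronglyMeasurable.aestronglyMeasurable

/-- The part of `D` on which `y = 0`, weighted by `f - y`. -/
noncomputable def positivePart (D : Measure Sample) : Measure Sample :=
  D.withDensity fun p => ENNReal.ofReal (residual p)

/-- The part of `D` on which `y = 1`, weighted by `y - f`. -/
noncomputable def negativePart (D : Measure Sample) : Measure Sample :=
  D.withDensity fun p => ENNReal.ofReal (-residual p)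

lemma positivePart_add_negativePart :
    positivePart D + negativePart D = D.withDensity fun p => ENNReal.ofReal |residual p| := by
  rw [positivePart, negativePart, ← withDensity_add_left (by fun_prop)]
  congr 1
  funext p
  rcases le_total 0 (residual p) with h | h
  · simp [abs_of_nonneg h, ENNReal.ofReal_of_nonpos (neg_nonpos.2 h)]
  · simp [abs_of_nonpos h, ENNReal.ofReal_of_nonpos h]

lemma withDensity_add_parts :
    D.withDensity (fun p => 1 - ENNReal.ofReal |residual p|) +
      (positivePart D + negativePart D) = D := by
  rw [positivePart_add_negativePart, ← withDensity_add_left (by fun_prop)]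
  have : (fun p : Sample => 1 - ENNReal.ofReal |residual p|) +
      (fun p => ENNReal.ofReal |residual p|) = 1 := by
    funext p
    exact tsub_add_cancel_of_le (ofReal_abs_residual_le_one p)
  rw [this, withDensity_one]

instance [IsFiniteMeasure D] : IsFiniteMeasure (positivePart D) :=
  isFiniteMeasure_of_le D (by
    conv_rhs => rw [← withDensity_add_parts (D := D)]
    rw [add_comm, add_assoc]
    exact Measure.le_add_right le_rfl)

instance [IsFiniteMeasure D] : IsFiniteMeasure (negativePart D) :=
  isFiniteMeasure_of_le D (by
    conv_rhs => rw [← withDensity_add_parts (D := D)]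
    rw [← add_assoc]
    exact Measure.le_add_left le_rfl)

lemma positivePart_univ_add_negativePart_univ_le [IsProbabilityMeasure D] :
    positivePart D Set.univ + negativePart D Set.univ ≤ 1 := by
  rw [← Measure.add_apply, ← measure_univ (μ := D)]
  conv_rhs => rw [← withDensity_add_parts (D := D)]
  exact (Measure.le_add_left le_rfl : positivePart D + negativePart D ≤ _) _

variable {h : unitInterval → EReal}

/-- By hypothesis the residual vanishes where `h` is infinite. -/
lemma ae_positivePart (hD : ∀ᵐ p ∂D, (h p.1 ≠ ⊥ ∧ h p.1 ≠ ⊤) ∨ (p.1 : ℝ) = outcome p.2) :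
    ∀ᵐ p ∂(positivePart D), p.2 = false ∧ h p.1 ≠ ⊥ ∧ h p.1 ≠ ⊤ := by
  rw [positivePart, ae_withDensity_iff (by fun_prop)]
  filter_upwards [hD] with p hp hne
  have hpos : 0 < residual p := by
    by_contra hle
    exact hne (ENNReal.ofReal_of_nonpos (not_lt.1 hle))
  refine ⟨?_, hp.resolve_right fun heq => hpos.ne' (sub_eq_zero.2 heq)⟩
  obtain ⟨⟨f, h0, h1⟩, y⟩ := p
  cases y
  · rfl
  · simp only [residual, outcome_true] at hpos
    linarith

lemma ae_negativePart (hD : ∀ᵐ p ∂D, (h p.1 ≠ ⊥ ∧ h p.1 ≠ ⊤) ∨ (p.1 : ℝ) = outcome p.2) :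
    ∀ᵐ p ∂(negativePart D), p.2 = true ∧ h p.1 ≠ ⊥ ∧ h p.1 ≠ ⊤ := by
  rw [negativePart, ae_withDensity_iff (by fun_prop)]
  filter_upwards [hD] with p hp hne
  have hneg : residual p < 0 := by
    by_contra hle
    exact hne (ENNReal.ofReal_of_nonpos (neg_nonpos.2 (not_lt.1 hle)))
  refine ⟨?_, hp.resolve_right fun heq => hneg.ne (sub_eq_zero.2 heq)⟩
  obtain ⟨⟨f, h0, h1⟩, y⟩ := p
  cases y
  · simp only [residual, outcome_false, sub_zero] at hneg
    linarith
  · rfl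

/-! ### The distance to calibration is bounded by the smoothed calibration error -/

/-- A partial coupling `γ` of the two parts of `D` yields a coupling of `D` with its recalibration.
A matched pair of `(f, 0)` and `(f', 1)` exchanges its predictions, a sample that is left over
changes its outcome, and the rest of `D` stays in place. -/
lemma wasserstein_recalibrated_le {γ : Measure (Sample × Sample)} {u v : Sample → ℝ≥0∞}
    (d : Sample → Sample → ℝ≥0∞) (hu : Measurable u) (hu1 : ∀ p, u p ≤ 1)
    (hfst : γ.map Prod.fst = (positivePart D).withDensity u) (hv : Measurable v)
    (hv1 : ∀ p, v p ≤ 1) (hsnd : γ.map Prod.snd = (negativePart D).withDensity v) :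
    wasserstein d D (recalibrated D) ≤
      ∫⁻ p, d p p ∂(D.withDensity fun p => 1 - ENNReal.ofReal |residual p|) +
      (∫⁻ z, d z.1 (flipLabel z.2) ∂γ + ∫⁻ z, d z.2 (flipLabel z.1) ∂γ +
      (∫⁻ p, d p (flipLabel p) ∂((positivePart D).withDensity fun p => 1 - u p) +
        ∫⁻ p, d p (flipLabel p) ∂((negativePart D).withDensity fun p => 1 - v p))) := by
  have split {A : Measure Sample} {w : Sample → ℝ≥0∞} (hw : Measurable w) (hw1 : ∀ p, w p ≤ 1) :
      A = A.withDensity w + A.withDensity fun p => 1 - w p := by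
    rw [← withDensity_add_left hw]
    have : (w + fun p => 1 - w p) = 1 := by
      funext p
      exact add_tsub_cancel_of_le (hw1 p)
    rw [this, withDensity_one]
  set R := D.withDensity fun p => 1 - ENNReal.ofReal |residual p| with hR
  set A' := (positivePart D).withDensity fun p => 1 - u p with hA'
  set B' := (negativePart D).withDensity fun p => 1 - v p with hB'
  have hA : positivePart D = γ.map Prod.fst + A' := by rw [hfst]; exact split hu hu1
  have hB : negativePart D = γ.map Prod.snd + B' := by rw [hsnd]; exact split hv hv1
  have m2 : Measurable fun z : Sample × Sample => (z.1, flipLabel z.2) := by fun_prop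
  have m3 : Measurable fun z : Sample × Sample => (z.2, flipLabel z.1) := by fun_prop
  have m1 : Measurable fun p : Sample => (p, p) := by fun_prop
  have m4 : Measurable fun p : Sample => (p, flipLabel p) := by fun_prop
  have hmem : R.map (fun p => (p, p)) + (γ.map (fun z => (z.1, flipLabel z.2)) +
      γ.map (fun z => (z.2, flipLabel z.1)) +
      (A'.map (fun p => (p, flipLabel p)) + B'.map fun p => (p, flipLabel p))) ∈
      Couplings D (recalibrated D) := by
    refine ⟨?_, ?_⟩
    · simp only [Measure.map_add _ _ measurable_fst]
      rw [Measure.map_map measurable_fst m1, Measure.map_map measurable_fst m2,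
        Measure.map_map measurable_fst m3, Measure.map_map measurable_fst m4,
        Measure.map_map measurable_fst m4]
      conv_rhs => rw [← withDensity_add_parts (D := D), hA, hB]
      change R.map id + (γ.map Prod.fst + γ.map Prod.snd + (A'.map id + B'.map id)) = _
      simp only [Measure.map_id]
      abel
    · simp only [Measure.map_add _ _ measurable_snd]
      rw [Measure.map_map measurable_snd m1, Measure.map_map measurable_snd m2,
        Measure.map_map measurable_snd m3, Measure.map_map measurable_snd m4,
        Measure.map_map measurable_snd m4, recalibrated, ← positivePart_add_negativePart, hA, hB]
      simp only [Measure.map_add _ _ measurable_flipLabel]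
      rw [Measure.map_map measurable_flipLabel measurable_fst,
        Measure.map_map measurable_flipLabel measurable_snd]
      change R.map id + (γ.map (flipLabel ∘ Prod.snd) + γ.map (flipLabel ∘ Prod.fst) +
        (A'.map flipLabel + B'.map flipLabel)) = _
      simp only [Measure.map_id]
      abel
  refine (iInf₂_le _ hmem).trans ?_
  simp only [lintegral_add_measure]
  exact add_le_add (lintegral_map_le _ _) (add_le_add (add_le_add (lintegral_map_le _ _)
    (lintegral_map_le _ _)) (add_le_add (lintegral_map_le _ _) (lintegral_map_le _ _)))

lemma sampleDist_flipLabel_self_le (d : unitInterval → unitInterval → ℝ≥0∞)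
    (hd : ∀ u, d u u = 0) (p : Sample) : sampleDist d p (flipLabel p) ≤ 1 := by
  obtain ⟨f, y⟩ := p
  cases y <;> simp [sampleDist, flipLabel, outcome, hd]

lemma inducedDist_self (h : unitInterval → EReal) (u : unitInterval) : inducedDist h u u = 0 := by
  simp [inducedDist, extDist]

lemma inducedDist_le {u v : unitInterval} (hu : h u ≠ ⊥ ∧ h u ≠ ⊤) (hv : h v ≠ ⊥ ∧ h v ≠ ⊤) :
    inducedDist h u v ≤ ENNReal.ofReal |(h u).toReal - (h v).toReal| := by
  refine (min_le_left _ _).trans (le_of_eq ?_)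
  rw [← extDist_coe, EReal.coe_toReal hu.2 hu.1, EReal.coe_toReal hv.2 hv.1]

lemma lintegral_abs_sub_toReal_mul_gaussianKernel_le {σ : ℝ} (hσ : 0 < σ) (a : EReal) :
    ∫⁻ t, ENNReal.ofReal |t - a.toReal| * ENNReal.ofReal (gaussianKernel σ t a) ≤
      ENNReal.ofReal σ := by
  induction a with
  | bot => simp
  | top => simp
  | coe x => exact lintegral_abs_sub_mul_gaussianKernel_le hσ x

lemma smoothing_gaussianKernel_ne_top (A : Measure Sample) [IsFiniteMeasure A] (σ t : ℝ) :
    smoothing (fun t (p : Sample) => ENNReal.ofReal (gaussianKernel σ t (h p.1))) A t ≠ ∞ := by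
  refine ((lintegral_mono fun p : Sample => ENNReal.ofReal_le_ofReal
    (gaussianKernel_le σ t (h p.1))).trans_lt ?_).ne
  rw [lintegral_const]
  exact ENNReal.mul_lt_top ENNReal.ofReal_lt_top (measure_lt_top _ _)

/-- The smoothed residual is the difference of the smoothed densities of the two parts of `D`. -/
lemma integral_gaussianKernel_mul_residual_eq_sub [IsFiniteMeasure D] (hh : Measurable h)
    (σ t : ℝ) : ∫ p, gaussianKernel σ t (h p.1) * residual p ∂D =
      (smoothing (fun t (p : Sample) => ENNReal.ofReal (gaussianKernel σ t (h p.1)))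
        (positivePart D) t).toReal -
      (smoothing (fun t (p : Sample) => ENNReal.ofReal (gaussianKernel σ t (h p.1)))
        (negativePart D) t).toReal := by
  have hk : Measurable fun p : Sample => ENNReal.ofReal (gaussianKernel σ t (h p.1)) := by fun_prop
  rw [integral_eq_lintegral_pos_part_sub_lintegral_neg_part
    (integrable_gaussianKernel_mul_residual hh σ t)]
  unfold smoothing positivePart negativePart
  rw [lintegral_withDensity_eq_lintegral_mul _ (by fun_prop) hk,
    lintegral_withDensity_eq_lintegral_mul _ (by fun_prop) hk]
  congr 2
  · refine lintegral_congr fun p => ?_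
    rw [Pi.mul_apply, mul_comm, ENNReal.ofReal_mul' (gaussianKernel_nonneg _ _ _)]
  · refine lintegral_congr fun p => ?_
    rw [Pi.mul_apply, mul_comm (gaussianKernel _ _ _), ← neg_mul,
      ENNReal.ofReal_mul' (gaussianKernel_nonneg _ _ _)]

lemma sub_add_sub_eq_ofReal_abs {a b : ℝ≥0∞} (ha : a ≠ ∞) (hb : b ≠ ∞) :
    (a - b) + (b - a) = ENNReal.ofReal |a.toReal - b.toReal| := by
  lift a to NNReal using ha
  lift b to NNReal using hb
  simp only [ENNReal.coe_toReal]
  rcases le_total a b with hab | hab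
  · have : (a : ℝ) ≤ b := hab
    rw [tsub_eq_zero_of_le (ENNReal.coe_le_coe.2 hab), zero_add, abs_sub_comm,
      abs_of_nonneg (sub_nonneg.2 this), ENNReal.ofReal_sub _ a.coe_nonneg,
      ENNReal.ofReal_coe_nnreal, ENNReal.ofReal_coe_nnreal]
  · have : (b : ℝ) ≤ a := hab
    rw [tsub_eq_zero_of_le (ENNReal.coe_le_coe.2 hab), add_zero,
      abs_of_nonneg (sub_nonneg.2 this), ENNReal.ofReal_sub _ b.coe_nonneg,
      ENNReal.ofReal_coe_nnreal, ENNReal.ofReal_coe_nnreal]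

/-- The first term pays for the exchange of predictions between matched samples, the second for the
outcomes of the samples that are left over. -/
lemma dCE_le_ofReal_add_smECE [IsProbabilityMeasure D] (hh : Measurable h)
    (hD : ∀ᵐ p ∂D, (h p.1 ≠ ⊥ ∧ h p.1 ≠ ⊤) ∨ (p.1 : ℝ) = outcome p.2) {σ : ℝ} (hσ : 0 < σ) :
    dCE (inducedDist h) D ≤ ENNReal.ofReal (2 * σ + smECE σ h D) := by
  set k : ℝ → Sample → ℝ≥0∞ := fun t p => ENNReal.ofReal (gaussianKernel σ t (h p.1)) with hk_def
  have hk : Measurable (Function.uncurry k) := by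
    unfold Function.uncurry
    fun_prop
  have hk1 (p : Sample) : ∫⁻ t, k t p ≤ 1 := lintegral_gaussianKernel_le_one hσ (h p.1)
  have hkfin {p : Sample} (hp : h p.1 ≠ ⊥ ∧ h p.1 ≠ ⊤) : ∫⁻ t, k t p = 1 := by
    simp only [hk_def]
    rw [← EReal.coe_toReal hp.2 hp.1]
    exact lintegral_gaussianKernel_coe hσ _
  have hAae := ae_positivePart hD
  have hBae := ae_negativePart hD
  let φ : ℝ → Sample → ℝ≥0∞ := fun t p => ENNReal.ofReal |t - (h p.1).toReal|
  have hφ : Measurable (Function.uncurry φ) := by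
    have : Measurable fun z : ℝ × Sample => (h z.2.1).toReal :=
      (hh.comp (measurable_fst.comp measurable_snd)).ereal_toReal
    exact (measurable_fst.sub this).abs.ennreal_ofReal
  let c : Sample × Sample → ℝ≥0∞ := fun z =>
    ENNReal.ofReal |(h z.1.1).toReal - (h z.2.1).toReal|
  have hc : Measurable c := by
    have h1 : Measurable fun z : Sample × Sample => (h z.1.1).toReal :=
      (hh.comp (measurable_fst.comp measurable_fst)).ereal_toReal
    have h2 : Measurable fun z : Sample × Sample => (h z.2.1).toReal :=
      (hh.comp (measurable_fst.comp measurable_snd)).ereal_toReal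
    exact (h1.sub h2).abs.ennreal_ofReal
  have hcφ (t : ℝ) (p q : Sample) : c (p, q) ≤ φ t p + φ t q := by
    simp only [c, φ]
    rw [← ENNReal.ofReal_add (abs_nonneg _) (abs_nonneg _), abs_sub_comm t (h p.1).toReal]
    exact ENNReal.ofReal_le_ofReal (abs_sub_le _ _ _)
  obtain ⟨γ, u, v, hac, hu, hu1, hfst, hv, hv1, hsnd, hleftA, hleftB, hcost⟩ :=
    exists_partial_coupling (A := positivePart D) (B := negativePart D) hk hk1
      (hAae.mono fun p hp => hkfin hp.2) (hBae.mono fun p hp => hkfin hp.2)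
      (smoothing_gaussianKernel_ne_top _ σ) (smoothing_gaussianKernel_ne_top _ σ) hφ hc hcφ
  have hγ : ∀ᵐ z ∂γ, (z.1.2 = false ∧ h z.1.1 ≠ ⊥ ∧ h z.1.1 ≠ ⊤) ∧
      (z.2.2 = true ∧ h z.2.1 ≠ ⊥ ∧ h z.2.1 ≠ ⊤) :=
    hac.ae_le ((Measure.quasiMeasurePreserving_fst.ae hAae).and
      (Measure.quasiMeasurePreserving_snd.ae hBae))
  -- the first absolute moment bounds the transport cost, as `A` and `B` have total mass at most `1`
  have hmatched : ∫⁻ z, c z ∂γ ≤ ENNReal.ofReal σ := by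
    have hφk (p : Sample) : ∫⁻ t, φ t p * k t p ≤ ENNReal.ofReal σ :=
      lintegral_abs_sub_toReal_mul_gaussianKernel_le hσ (h p.1)
    calc _ ≤ _ := hcost
      _ ≤ ENNReal.ofReal σ * positivePart D Set.univ +
          ENNReal.ofReal σ * negativePart D Set.univ := by
        rw [← lintegral_const, ← lintegral_const]
        exact add_le_add (lintegral_mono hφk) (lintegral_mono hφk)
      _ ≤ ENNReal.ofReal σ := by
        rw [← mul_add]
        exact mul_le_of_le_one_right' positivePart_univ_add_negativePart_univ_le
  -- `A` lives on `y = 0` and `B` on `y = 1`, so that a partner with its outcome flipped agrees in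
  -- the outcome and only the predictions contribute to the cost
  have hcost1 : ∫⁻ z, sampleDist (inducedDist h) z.1 (flipLabel z.2) ∂γ ≤ ∫⁻ z, c z ∂γ := by
    refine lintegral_mono_ae (hγ.mono fun z hz => ?_)
    simpa [sampleDist, flipLabel, hz.1.1, hz.2.1, outcome] using inducedDist_le hz.1.2 hz.2.2
  have hcost2 : ∫⁻ z, sampleDist (inducedDist h) z.2 (flipLabel z.1) ∂γ ≤ ∫⁻ z, c z ∂γ := by
    refine lintegral_mono_ae (hγ.mono fun z hz => ?_)
    simpa [sampleDist, flipLabel, hz.1.1, hz.2.1, outcome, c, abs_sub_comm (h z.1.1).toReal]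
      using inducedDist_le hz.2.2 hz.1.2
  have hflip {A : Measure Sample} {w : Sample → ℝ≥0∞} :
      ∫⁻ p, sampleDist (inducedDist h) p (flipLabel p) ∂(A.withDensity fun p => 1 - w p) ≤
        ∫⁻ p, (1 - w p) ∂A := by
    refine (lintegral_mono (g := fun _ => 1)
      (sampleDist_flipLabel_self_le _ (inducedDist_self h))).trans ?_
    rw [lintegral_one, withDensity_apply _ MeasurableSet.univ, Measure.restrict_univ]
  -- the leftover masses `∫ (a - b)⁺` and `∫ (b - a)⁺` add up to `∫ |a - b|`
  have hleft : ∫⁻ p, (1 - u p) ∂(positivePart D) + ∫⁻ p, (1 - v p) ∂(negativePart D) ≤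
      ENNReal.ofReal (smECE σ h D) := by
    refine (add_le_add hleftA hleftB).trans ?_
    have hab : Measurable fun t => smoothing k (positivePart D) t -
        smoothing k (negativePart D) t :=
      (measurable_smoothing hk _).sub (measurable_smoothing hk _)
    rw [← lintegral_add_left hab, ofReal_smECE hh hσ]
    refine lintegral_mono fun t => ?_
    rw [sub_add_sub_eq_ofReal_abs (smoothing_gaussianKernel_ne_top _ σ t)
      (smoothing_gaussianKernel_ne_top _ σ t), integral_gaussianKernel_mul_residual_eq_sub hh]
  calc dCE (inducedDist h) D ≤ wasserstein (sampleDist (inducedDist h)) D (recalibrated D) :=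
        iInf₂_le _ ⟨inferInstance, perfectlyCalibrated_recalibrated⟩
    _ ≤ 0 + (ENNReal.ofReal σ + ENNReal.ofReal σ + ENNReal.ofReal (smECE σ h D)) := by
        refine (wasserstein_recalibrated_le _ hu hu1 hfst hv hv1 hsnd).trans ?_
        refine add_le_add (le_of_eq ?_) (add_le_add (add_le_add (hcost1.trans hmatched)
          (hcost2.trans hmatched)) ((add_le_add hflip hflip).trans hleft))
        simp [sampleDist, inducedDist_self]
    _ = ENNReal.ofReal (2 * σ + smECE σ h D) := by
        rw [zero_add, ← ENNReal.ofReal_add hσ.le hσ.le,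
          ← ENNReal.ofReal_add (by positivity) (smECE_nonneg σ), two_mul]

lemma IsSmECEStar.dCE_le [IsProbabilityMeasure D] (hh : Measurable h)
    (hD : ∀ᵐ p ∂D, (h p.1 ≠ ⊥ ∧ h p.1 ≠ ⊤) ∨ (p.1 : ℝ) = outcome p.2) {σ : ℝ}
    (hσ : IsSmECEStar h D σ) : dCE (inducedDist h) D ≤ ENNReal.ofReal (3 * σ) := by
  rcases hσ with ⟨hpos, hfix⟩ | ⟨rfl, hvan⟩
  · refine (dCE_le_ofReal_add_smECE hh hD hpos).trans_eq ?_
    rw [hfix]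
    ring_nf
  · -- the bound `2 τ` at every scale `τ > 0` forces the distance to be zero
    rw [mul_zero, ENNReal.ofReal_zero]
    have hlim : Filter.Tendsto (fun τ : ℝ => ENNReal.ofReal (2 * τ)) (nhdsWithin 0 (Set.Ioi 0))
        (nhds 0) := by
      have hcont : Continuous fun τ : ℝ => ENNReal.ofReal (2 * τ) :=
        ENNReal.continuous_ofReal.comp (continuous_const.mul continuous_id)
      have := hcont.tendsto 0
      rw [mul_zero, ENNReal.ofReal_zero] at this
      exact this.mono_left nhdsWithin_le_nhds
    refine ge_of_tendsto hlim ?_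
    filter_upwards [self_mem_nhdsWithin] with τ hτ
    simpa [hvan τ hτ] using dCE_le_ofReal_add_smECE hh hD hτ

end

end SmoothECE

theorem mainTheorem3 :
    ∃ c : ℝ, 0 < c ∧ ∀ L : ℝ, 0 < L → ∃ C : ℝ, 0 < C ∧
      ∀ h : unitInterval → EReal, StrictMono h → Continuous h →
      ∀ D : Measure SmoothECE.Sample, IsProbabilityMeasure D →
      (∀ᵐ p ∂D, (h p.1 ≠ ⊥ ∧ h p.1 ≠ ⊤) ∨ (p.1 : ℝ) = SmoothECE.outcome p.2) →
        (∃! σ : ℝ, SmoothECE.IsSmECEStar h D σ) ∧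
        ∀ σ : ℝ, SmoothECE.IsSmECEStar h D σ →
          SmoothECE.dCE (SmoothECE.inducedDist h) D ≤ ENNReal.ofReal (c * σ) ∧
          ((∀ u v : unitInterval, ENNReal.ofReal |(u : ℝ) - (v : ℝ)| ≤
              ENNReal.ofReal L * SmoothECE.inducedDist h u v) →
            ENNReal.ofReal σ ≤
              ENNReal.ofReal C * SmoothECE.dCE (SmoothECE.inducedDist h) D ^ (1 / 2 : ℝ)) := by
  refine ⟨3, by norm_num, fun L hL => ⟨√(L + 3), Real.sqrt_pos.2 (by linarith), ?_⟩⟩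
  intro h _ hcont D hprob hD
  have hh : Measurable h := hcont.measurable
  exact ⟨SmoothECE.existsUnique_isSmECEStar hh, fun σ hσ =>
    ⟨hσ.dCE_le hh hD, fun hlip => hσ.le_sqrt_mul_dCE hh hL hlip⟩⟩
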